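/- For a finite set of input bits, a Boolean circuit is a single-output circuit of unbounded fan-out with NOT gates and fan-in-two AND and OR gates, whose gates may read input bits, the constants $0,1$, and earlier gates; its size is its number of gates. For probability distributions $P,Q$ on a cube $\{0,1\}^m$ and $s\in\mathbb N$, let $$d_s(P,Q)=\sup_{C}\bigl|\Pr_{x\sim P}[C(x)=1]-\Pr_{x\sim Q}[C(x)=1]\bigr|,$$ where $C$ ranges over the Boolean circuits with $m$ input bits and size at most $s$. Let $d_{\mathrm{TV}}(P,Q)=\frac12\sum_x|P(x)-Q(x)|$, and let $P^{\otimes k}$ be the distribution on $(\{0,1\}^m)^k=\{0,1\}^{km}$ of $k$ independent samples from $P$. **Theorem.** There are absolute constants $A,c\in\mathbb N$ such that the following two statements hold. (1) For all $s,k\in\mathbb N$ (zero allowed) and all real $\varepsilon>0$ there is an $s'\in\mathbb N$ with $$s'\le A\,\frac{sk}{\varepsilon^2}+\Bigl(\frac k\varepsilon\Bigr)^{c}$$ such that for all $n\in\mathbb N$ and all probability distributions $\mathcal D_0,\mathcal D_1$ on $\{0,1\}^n$ there exist probability distributions $\widetilde{\mathcal D}_0,\widetilde{\mathcal D}_1$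 on $\{0,1\}^n$ with $d_s(\mathcal D_b,\widetilde{\mathcal D}_b)\le\varepsilon$ for $b\in\{0,1\}$ and $$d_s(\mathcal D_0^{\otimes k},\mathcal D_1^{\otimes k})-k\varepsilon\;\le\; d_{\mathrm{TV}}(\widetilde{\mathcal D}_0^{\otimes k},\widetilde{\mathcal D}_1^{\otimes k})\;\le\; d_{s'}(\mathcal D_0^{\otimes k},\mathcal D_1^{\otimes k})+k\varepsilon .$$ (2) The same holds with the additional requirement $\widetilde{\mathcal D}_0=\mathcal D_0$, when the bound on $s'$ is replaced by $$s'\le A\,\frac{sk}{\varepsilon^4}+\Bigl(\frac k\varepsilon\Bigr)^{c}.$$ -/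

import Mathlib

namespace CircuitDist

/-- What can feed a gate (or be the output) of a Boolean circuit with input bits indexed by `ι`
in which `s` gates are available: a constant, an input bit, or the output of a gate. -/
inductive Source (ι : Type) (s : ℕ) : Type
  | const (b : Bool) : Source ι s
  | input (i : ι) : Source ι s
  | gate (j : Fin s) : Source ι s

/-- A NOT, AND or OR gate, of fan-in at most two. -/
inductive Gate (ι : Type) (s : ℕ) : Type
  | not (a : Source ι s) : Gate ι s
  | and (a b : Source ι s) : Gate ι s
  | or (a b : Source ι s) : Gate ι s

/-- A list of `s` gates in topological order: each gate reads constants, input bits and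
earlier gates (fan-out is unbounded). -/
inductive GateSeq (ι : Type) : ℕ → Type
  | nil : GateSeq ι 0
  | snoc {s : ℕ} (c : GateSeq ι s) (g : Gate ι s) : GateSeq ι (s + 1)

/-- A Boolean circuit of size `s`, i.e. with exactly `s` gates, and one output bit. Input bits
and constants are not counted in the size. -/
structure Circuit (ι : Type) (s : ℕ) where
  gates : GateSeq ι s
  output : Source ι s

variable {ι : Type}

def Source.eval {s : ℕ} (x : ι → Bool) (v : Fin s → Bool) : Source ι s → Bool
  | .const b => b
  | .input i => x i
  | .gate j => v j

def Gate.eval {s : ℕ} (x : ι → Bool) (v : Fin s → Bool) : Gate ι s → Bool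
  | .not a => !(a.eval x v)
  | .and a b => a.eval x v && b.eval x v
  | .or a b => a.eval x v || b.eval x v

/-- The values of all gates on input `x`. -/
def GateSeq.eval (x : ι → Bool) : {s : ℕ} → GateSeq ι s → Fin s → Bool
  | _, .nil => Fin.elim0
  | _, .snoc c g => Fin.snoc (α := fun _ => Bool) (c.eval x) (g.eval x (c.eval x))

/-- The output bit of the circuit on input `x`. -/
def Circuit.eval {s : ℕ} (c : Circuit ι s) (x : ι → Bool) : Bool :=
  c.output.eval x (c.gates.eval x)

/-- The probability that `f` outputs `1` on a sample from `P`. -/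
noncomputable def accept {α : Type} [Fintype α] (P : PMF α) (f : α → Bool) : ℝ :=
  ∑ x, if f x then (P x).toReal else 0

/-- `dCirc s P Q` is the best distinguishing advantage between `P` and `Q` attainable by a
Boolean circuit of size at most `s`. -/
noncomputable def dCirc [Fintype ι] [DecidableEq ι] (s : ℕ) (P Q : PMF (ι → Bool)) : ℝ :=
  sSup {a : ℝ | ∃ t : ℕ, t ≤ s ∧ ∃ c : Circuit ι t, a = |accept P c.eval - accept Q c.eval|}

/-- Total variation distance on a finite set. -/
noncomputable def dTV {α : Type} [Fintype α] (P Q : PMF α) : ℝ :=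
  (1 / 2) * ∑ x, |(P x).toReal - (Q x).toReal|

theorem sum_iid {n : ℕ} (D : PMF (Fin n → Bool)) (k : ℕ) :
    ∑ x : Fin k × Fin n → Bool, ∏ i : Fin k, D (fun j => x (i, j)) = 1 := by
  have h1 : ∑ y : Fin n → Bool, D y = 1 := by
    rw [← tsum_fintype (L := SummationFilter.unconditional _)]
    exact D.tsum_coe
  have h2 : ∑ x : Fin k × Fin n → Bool, ∏ i : Fin k, D (fun j => x (i, j))
      = ∑ z : Fin k → Fin n → Bool, ∏ i : Fin k, D (z i) :=
    Fintype.sum_equiv (Equiv.curry (Fin k) (Fin n) Bool) _ _ (fun _ => rfl)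
  rw [h2, ← Fintype.piFinset_univ, ← Finset.prod_univ_sum]
  simp [h1]

/-- The law of `k` independent samples from `D`, where the `j`-th bit of the `i`-th sample is
the bit with index `(i, j)`. -/
noncomputable def iid {n : ℕ} (D : PMF (Fin n → Bool)) (k : ℕ) :
    PMF (Fin k × Fin n → Bool) :=
  PMF.ofFintype (fun x => ∏ i : Fin k, D (fun j => x (i, j))) (sum_iid D k)

end CircuitDist

/-!
The proxies come from boosting. An integer-valued level function `h` on the cube starts at `0` and
moves by `±1` on sets `{x | C x = 1, h x < c}`, with `C` a circuit of size at most `s`, as long as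
such a test tells `D₁` from the weight `Q₁` that `h` encodes. A convex potential drops by a fixed
amount in each step (`exists_potential_step`), which bounds the number `t` of steps
(`exists_boost`). At the end `Q₁`, normalized (`exists_pmf_normalize`), fools all circuits of size
`s` and all thresholds of `h`.

* For two proxies (`exists_two_proxies`) the boosting is logistic: with `η` of order `ε`,
  `Q₁ = (D₀ + D₁) * σ (η * h)` and `Q₀ = (D₀ + D₁) * (1 - σ (η * h))` for the sigmoid `σ`. The
  potential starts at `2 * log 2` and is nonnegative, so `t = O(1 / ε ^ 2)`.
* For a single proxy (`exists_single_proxy`) `Q₁ = D₀ * exp (η * h)`, with `h` frozen once it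
  reaches a cap `K`, and `Q₁ = D₁` on the frozen set. With `B = η * K` of order `1 / ε`, the
  potential stays between `-B` and `1`, so `t = O(1 / ε ^ 3)`, and it bounds the `D₀`-probability
  of the frozen set by `(1 + B) * exp (-B) ≤ ε / 2`.

In both cases the likelihood ratio of the proxies is proportional to `exp (η * h)` where `h < K`.
So for `k` samples the test "`∑ i, h (x i) ≥ θ`, or `h (x i) ≥ K` for some `i`" is optimal, up to
the probability of the frozen set (`exists_dTV_iid_le_sumTest`). Restricted to a single sample it is
a threshold of `h`, hence by the hybrid argument it accepts the `k`-fold products of the given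
distributions almost as often as those of their proxies (`abs_accept_iid_sumTest_sub_le`). Because
levels are integers, they can be kept in unary and added with polynomially many gates, while each
boosting step calls one circuit of size `s` per sample; so the test has a circuit of size
`k * t * s + poly (k * t)` (`BoostSteps.exists_circuit_sumTest`). This is the upper bound. The lower
bound is the hybrid argument for circuits (`dCirc_iid_sub_le_dTV_iid`).
-/

namespace CircuitDist

/-! ### Circuits built by adding gates -/

section Circuits

variable {ι : Type}

/-- The Boolean functions that a further gate may read once the gates of `c` are in place. -/
def GateSeq.avail {s : ℕ} (c : GateSeq ι s) : Set ((ι → Bool) → Bool) :=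
  {f | ∃ a : Source ι s, ∀ x, f x = a.eval x (c.eval x)}

/-- `Derivable m G F`: whenever all functions in `G` are available in a gate sequence, it can be
extended by at most `m` gates so that all functions in `F` become available as well. -/
def Derivable (m : ℕ) (G F : Set ((ι → Bool) → Bool)) : Prop :=
  ∀ (s : ℕ) (c : GateSeq ι s), G ⊆ c.avail →
    ∃ s' ≤ s + m, ∃ c' : GateSeq ι s', c.avail ⊆ c'.avail ∧ F ⊆ c'.avail

theorem Derivable.of_subset {m : ℕ} {G F : Set ((ι → Bool) → Bool)} (h : F ⊆ G) :
    Derivable m G F :=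
  fun s c hc => ⟨s, by omega, c, subset_rfl, h.trans hc⟩

theorem Derivable.mono {m m' : ℕ} {G G' F F' : Set ((ι → Bool) → Bool)} (h : Derivable m G F)
    (hm : m ≤ m') (hG : G ⊆ G') (hF : F' ⊆ F) : Derivable m' G' F' := by
  intro s c hc
  obtain ⟨s', hs', c', h1, h2⟩ := h s c (hG.trans hc)
  exact ⟨s', by omega, c', h1, hF.trans h2⟩

theorem Derivable.trans {m m' : ℕ} {G F F' : Set ((ι → Bool) → Bool)} (h : Derivable m G F)
    (h' : Derivable m' (G ∪ F) F') : Derivable (m + m') G (F ∪ F') := by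
  intro s c hc
  obtain ⟨s₁, hs₁, c₁, h1, h2⟩ := h s c hc
  obtain ⟨s₂, hs₂, c₂, h3, h4⟩ := h' s₁ c₁ (Set.union_subset (hc.trans h1) h2)
  exact ⟨s₂, by omega, c₂, h1.trans h3, Set.union_subset (h2.trans h3) h4⟩

theorem Derivable.union {m m' : ℕ} {G F F' : Set ((ι → Bool) → Bool)} (h : Derivable m G F)
    (h' : Derivable m' G F') : Derivable (m + m') G (F ∪ F') :=
  h.trans (h'.mono le_rfl Set.subset_union_left subset_rfl)

theorem Derivable.biUnion {κ : Type} {m : ℕ} {G : Set ((ι → Bool) → Bool)}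
    {F : κ → Set ((ι → Bool) → Bool)} (J : Finset κ) (h : ∀ j ∈ J, Derivable m G (F j)) :
    Derivable (J.card * m) G (⋃ j ∈ J, F j) := by
  classical
  induction J using Finset.induction_on with
  | empty => exact .of_subset (by simp)
  | insert a J ha ih =>
    have h1 := (h a (by simp)).union (ih fun j hj => h j (by simp [hj]))
    refine h1.mono ?_ subset_rfl (by simp)
    rw [Finset.card_insert_of_notMem ha]
    apply le_of_eq; ring

theorem Derivable.const (b : Bool) (G : Set ((ι → Bool) → Bool)) :
    Derivable 0 G {fun _ => b} :=
  fun s c _ => ⟨s, by omega, c, subset_rfl, by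
    rintro f rfl; exact ⟨.const b, fun x => rfl⟩⟩

theorem Derivable.input (i : ι) (G : Set ((ι → Bool) → Bool)) :
    Derivable 0 G {fun x => x i} :=
  fun s c _ => ⟨s, by omega, c, subset_rfl, by
    rintro f rfl; exact ⟨.input i, fun x => rfl⟩⟩

theorem GateSeq.avail_snoc {s : ℕ} (c : GateSeq ι s) (g : Gate ι s) :
    c.avail ⊆ (c.snoc g).avail := by
  rintro f ⟨a, ha⟩
  cases a with
  | const b => exact ⟨.const b, ha⟩
  | input i => exact ⟨.input i, ha⟩
  | gate j =>
    refine ⟨.gate j.castSucc, fun x => ?_⟩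
    rw [ha x]
    simp [Source.eval, GateSeq.eval, Fin.snoc_castSucc]

theorem GateSeq.gate_mem_avail_snoc {s : ℕ} (c : GateSeq ι s) (g : Gate ι s) :
    (fun x => g.eval x (c.eval x)) ∈ (c.snoc g).avail := by
  refine ⟨.gate (Fin.last s), fun x => ?_⟩
  simp [Source.eval, GateSeq.eval, Fin.snoc_last]

theorem Derivable.not {f : (ι → Bool) → Bool} {G : Set ((ι → Bool) → Bool)} (hf : f ∈ G) :
    Derivable 1 G {fun x => !f x} := by
  intro s c hc
  obtain ⟨a, ha⟩ := hc hf
  refine ⟨s + 1, le_rfl, c.snoc (.not a), c.avail_snoc _, ?_⟩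
  rintro _ rfl
  convert c.gate_mem_avail_snoc (.not a) using 2 with x
  simp [Gate.eval, ha]

theorem Derivable.and {f g : (ι → Bool) → Bool} {G : Set ((ι → Bool) → Bool)} (hf : f ∈ G)
    (hg : g ∈ G) : Derivable 1 G {fun x => f x && g x} := by
  intro s c hc
  obtain ⟨a, ha⟩ := hc hf
  obtain ⟨b, hb⟩ := hc hg
  refine ⟨s + 1, le_rfl, c.snoc (.and a b), c.avail_snoc _, ?_⟩
  rintro _ rfl
  convert c.gate_mem_avail_snoc (.and a b) using 2 with x
  simp [Gate.eval, ha, hb]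

theorem Derivable.or {f g : (ι → Bool) → Bool} {G : Set ((ι → Bool) → Bool)} (hf : f ∈ G)
    (hg : g ∈ G) : Derivable 1 G {fun x => f x || g x} := by
  intro s c hc
  obtain ⟨a, ha⟩ := hc hf
  obtain ⟨b, hb⟩ := hc hg
  refine ⟨s + 1, le_rfl, c.snoc (.or a b), c.avail_snoc _, ?_⟩
  rintro _ rfl
  convert c.gate_mem_avail_snoc (.or a b) using 2 with x
  simp [Gate.eval, ha, hb]

theorem Derivable.exists_circuit {m : ℕ} {f : (ι → Bool) → Bool} (h : Derivable m ∅ {f}) :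
    ∃ t ≤ m, ∃ C : Circuit ι t, C.eval = f := by
  obtain ⟨t, ht, c, -, hF⟩ := h 0 .nil (Set.empty_subset _)
  obtain ⟨a, ha⟩ := hF (Set.mem_singleton f)
  exact ⟨t, by omega, ⟨c, a⟩, funext fun x => (ha x).symm⟩

section Substitution

variable {ι' : Type} {φ : (ι → Bool) → ι' → Bool}

/-- The functions that a gate sequence on the bits `φ x` makes available can be computed from
`x`, gate by gate, when every bit of `φ x` is a bit of `x`. -/
theorem Derivable.gateSeq (hφ : ∀ j, ∃ i, ∀ x, φ x j = x i) {t : ℕ} (c : GateSeq ι' t)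
    (G : Set ((ι → Bool) → Bool)) :
    Derivable t G (Set.range fun j x => c.eval (φ x) j) := by
  induction c with
  | nil => exact .of_subset (by rintro _ ⟨j, rfl⟩; exact j.elim0)
  | @snoc t c g ih =>
    have hsrc : ∀ a : Source ι' t, Derivable 0 (G ∪ Set.range fun j x => c.eval (φ x) j)
        {fun x => a.eval (φ x) (c.eval (φ x))} := by
      rintro (b | j | j)
      · exact .const b _
      · obtain ⟨i, hi⟩ := hφ j
        simpa [Source.eval, hi] using Derivable.input i _
      · exact .of_subset (Set.singleton_subset_iff.2 (Or.inr ⟨j, rfl⟩))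
    have hg : Derivable 1 (G ∪ Set.range fun j x => c.eval (φ x) j)
        {fun x => g.eval (φ x) (c.eval (φ x))} := by
      cases g with
      | not a =>
        exact ((hsrc a).trans (.not (by simp))).mono (by omega) subset_rfl
          (Set.subset_union_right)
      | and a b =>
        exact (((hsrc a).union (hsrc b)).trans (.and (f := fun x => a.eval (φ x) (c.eval (φ x)))
          (g := fun x => b.eval (φ x) (c.eval (φ x))) (by simp) (by simp))).mono
            (by omega) subset_rfl Set.subset_union_right
      | or a b =>
        exact (((hsrc a).union (hsrc b)).trans (.or (f := fun x => a.eval (φ x) (c.eval (φ x)))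
          (g := fun x => b.eval (φ x) (c.eval (φ x))) (by simp) (by simp))).mono
            (by omega) subset_rfl Set.subset_union_right
    refine (ih.trans hg).mono le_rfl subset_rfl ?_
    rintro _ ⟨j, rfl⟩
    induction j using Fin.lastCases with
    | last => right; simp [GateSeq.eval]
    | cast j => left; exact ⟨j, by simp [GateSeq.eval]⟩

theorem Derivable.circuit (hφ : ∀ j, ∃ i, ∀ x, φ x j = x i) {t : ℕ} (C : Circuit ι' t)
    (G : Set ((ι → Bool) → Bool)) : Derivable t G {fun x => C.eval (φ x)} := by
  obtain ⟨c, a⟩ := C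
  refine ((Derivable.gateSeq hφ c G).trans (m' := 0)
    (F' := {fun x => a.eval (φ x) (c.eval (φ x))}) ?_).mono le_rfl subset_rfl
    Set.subset_union_right
  rcases a with b | j | j
  · exact .const b _
  · obtain ⟨i, hi⟩ := hφ j
    simpa [Source.eval, hi] using Derivable.input i _
  · exact .of_subset (Set.singleton_subset_iff.2 (Or.inr ⟨j, rfl⟩))

end Substitution

/-! ### Unary arithmetic in circuits -/

/-- The unary representation of an integer-valued function `h`: all bits `[j ≤ h]`. When `h` is
bounded, all but finitely many of them are constant and hence free. -/
def levels (h : (ι → Bool) → ℤ) : Set ((ι → Bool) → Bool) :=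
  Set.range fun (j : ℤ) x => decide (j ≤ h x)

/-- Adding `σ` to `h` where `e` holds takes one multiplexer of three gates per level: the new bit
`[j ≤ h']` is the old bit `[j - σ ≤ h]` if `e` holds, and the old bit `[j ≤ h]` otherwise. -/
theorem Derivable.levels_add_ite {R : ℕ} {h : (ι → Bool) → ℤ} (hR : ∀ x, |h x| ≤ R)
    {e : (ι → Bool) → Bool} {σ : ℤ} (hσ : |σ| = 1) {G : Set ((ι → Bool) → Bool)}
    (hG : levels h ⊆ G) (he : e ∈ G) :
    Derivable (6 * R + 7) G (levels fun x => h x + if e x then σ else 0) := by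
  have hl : ∀ j : ℤ, (fun x => decide (j ≤ h x)) ∈ G := fun j => hG ⟨j, rfl⟩
  set h' : (ι → Bool) → ℤ := fun x => h x + if e x then σ else 0 with hh'
  have hσ' : -1 ≤ σ ∧ σ ≤ 1 := abs_le.1 hσ.le
  have key : ∀ j : ℤ, Derivable 3 (G ∪ {fun x => !e x}) {fun x => decide (j ≤ h' x)} := by
    intro j
    have h1 : Derivable 1 (G ∪ {fun x => !e x}) {fun x => e x && decide (j - σ ≤ h x)} :=
      .and (Or.inl he) (Or.inl (hl _))
    have h2 : Derivable 1 (G ∪ {fun x => !e x}) {fun x => !e x && decide (j ≤ h x)} :=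
      .and (Or.inr rfl) (Or.inl (hl _))
    refine ((h1.union h2).trans (.or (f := fun x => e x && decide (j - σ ≤ h x))
      (g := fun x => !e x && decide (j ≤ h x)) (by simp) (by simp))).mono le_rfl subset_rfl ?_
    rw [Set.singleton_subset_iff]
    right
    rw [Set.mem_singleton_iff]
    funext x
    cases hx : e x <;> simp [hh', hx]
  have h3 := (Derivable.not he).trans (Derivable.biUnion (Finset.Icc (-R : ℤ) (R + 1))
    (fun j _ => key j))
  have h4 := h3.union ((Derivable.const true G).union (Derivable.const false G))
  refine h4.mono ?_ subset_rfl ?_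
  · simp only [Int.card_Icc]; omega
  · rintro _ ⟨j, rfl⟩
    have hb : ∀ x, -R - 1 ≤ h' x ∧ h' x ≤ R + 1 := by
      intro x
      have := abs_le.1 (hR x)
      simp only [hh']
      split_ifs <;> omega
    by_cases hj : j ∈ Finset.Icc (-R : ℤ) (R + 1)
    · left; right
      simp only [Set.mem_iUnion]
      exact ⟨j, hj, rfl⟩
    · right
      rw [Finset.mem_Icc, not_and_or] at hj
      rcases hj with hj | hj
      · left
        rw [Set.mem_singleton_iff]
        funext x
        have := hb x
        simp only [decide_eq_true_eq]
        omega
      · right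
        rw [Set.mem_singleton_iff]
        funext x
        have := hb x
        simp only [decide_eq_false_iff_not]
        omega

/-! ### Boosted level functions -/

/-- `BoostSteps ι s t h`: the integer-valued function `h` arises from `0` in `t` steps, each of
which adds `1` or `-1` on a set of the form `{x | C x = 1, h x < c}`, for a circuit `C` of size
at most `s`. -/
inductive BoostSteps (ι : Type) (s : ℕ) : ℕ → ((ι → Bool) → ℤ) → Prop
  | zero : BoostSteps ι s 0 fun _ => 0
  | step {t r : ℕ} {h : (ι → Bool) → ℤ} (hh : BoostSteps ι s t h) (hr : r ≤ s)
      (C : Circuit ι r) (c : ℤ) {σ : ℤ} (hσ : |σ| = 1) :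
      BoostSteps ι s (t + 1) fun x => h x + if C.eval x && decide (h x < c) then σ else 0

theorem BoostSteps.abs_le {s t : ℕ} {h : (ι → Bool) → ℤ} (hh : BoostSteps ι s t h)
    (x : ι → Bool) : |h x| ≤ t := by
  induction hh with
  | zero => simp
  | @step t r h hh hr C c σ hσ ih =>
    have h1 := _root_.abs_le.1 ih
    have h2 := _root_.abs_le.1 hσ.le
    rw [_root_.abs_le]
    push_cast
    split_ifs <;> constructor <;> linarith

/-- A boosted level function of the bits `φ x` and its sum with a function `H` that is already
given in unary are computed together: every step updates both. -/
theorem BoostSteps.derivable {ι' : Type} {φ : (ι → Bool) → ι' → Bool}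
    (hφ : ∀ j, ∃ i, ∀ x, φ x j = x i) {s t M R : ℕ} {h : (ι' → Bool) → ℤ}
    (hh : BoostSteps ι' s t h) {H : (ι → Bool) → ℤ} (hH : ∀ x, |H x| ≤ M) (hR : M + t ≤ R) :
    Derivable (t * (s + 12 * R + 16)) (levels H)
      (levels (fun x => h (φ x)) ∪ levels (fun x => H x + h (φ x))) := by
  induction hh with
  | zero =>
    have : levels (fun _ : ι → Bool => (0 : ℤ)) ⊆ {fun _ => true} ∪ {fun _ => false} := by
      rintro _ ⟨j, rfl⟩
      by_cases hj : j ≤ 0 <;> simp [hj]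
    refine (((Derivable.const true _).union (.const false _)).union
      (.of_subset (m := 0) subset_rfl)).mono (by omega) subset_rfl ?_
    simp only [add_zero]
    exact Set.union_subset_union_left _ this
  | @step t r h hh hr C c σ hσ ih =>
    set F := levels (fun x => h (φ x)) ∪ levels (fun x => H x + h (φ x)) with hF
    set e : (ι → Bool) → Bool := fun x => C.eval (φ x) && decide (h (φ x) < c) with he
    have h1 : Derivable s (levels H ∪ F) {fun x => C.eval (φ x)} :=
      (Derivable.circuit hφ C _).mono hr subset_rfl subset_rfl
    have h2 : Derivable 1 (levels H ∪ F) {fun x => !decide (c ≤ h (φ x))} :=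
      .not (Or.inr (Or.inl ⟨c, rfl⟩))
    have h3 : Derivable (s + 1 + 1) (levels H ∪ F) {e} := by
      refine ((h1.union h2).trans (.and (f := fun x => C.eval (φ x))
        (g := fun x => !decide (c ≤ h (φ x))) (by simp) (by simp))).mono le_rfl subset_rfl ?_
      rw [Set.singleton_subset_iff]
      right
      rw [Set.mem_singleton_iff]
      funext x
      simp only [he, ← not_lt, decide_not, Bool.not_not]
    have hb1 : ∀ x, |h (φ x)| ≤ (R : ℕ) := fun x => (hh.abs_le (φ x)).trans (by
      exact_mod_cast (by omega : t ≤ R))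
    have hb2 : ∀ x, |H x + h (φ x)| ≤ (R : ℕ) := fun x => by
      have h1 := hh.abs_le (φ x)
      have h2 := hH x
      have h3 := abs_add_le (H x) (h (φ x))
      have h4 : (M : ℤ) + t ≤ R := by exact_mod_cast (by omega : M + t ≤ R)
      linarith
    have h4 : Derivable (6 * R + 7) (levels H ∪ F ∪ {e}) _ :=
      .levels_add_ite hb1 hσ (fun f hf => Or.inl (Or.inr (Or.inl hf))) (Or.inr rfl)
    have h5 : Derivable (6 * R + 7) (levels H ∪ F ∪ {e}) _ :=
      .levels_add_ite hb2 hσ (fun f hf => Or.inl (Or.inr (Or.inr hf))) (Or.inr rfl)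
    refine ((ih (by omega)).trans (h3.trans (h4.union h5))).mono ?_ subset_rfl ?_
    · apply le_of_eq; ring
    · simp only [he, ← add_assoc]
      exact Set.subset_union_right.trans Set.subset_union_right

/-- The test on `k` samples `x i` of `n` bits that accepts if `∑ i, h (x i) ≥ θ`, or if
`h (x i) ≥ K` for some `i`. -/
def sumTest {n k : ℕ} (h : (Fin n → Bool) → ℤ) (θ K : ℤ) (x : Fin k × Fin n → Bool) : Bool :=
  decide (θ ≤ ∑ i, h fun j => x (i, j)) || decide (∃ i, K ≤ h fun j => x (i, j))

theorem BoostSteps.exists_circuit_sumTest {n k s t : ℕ} {h : (Fin n → Bool) → ℤ}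
    (hh : BoostSteps (Fin n) s t h) (θ K : ℤ) :
    ∃ r ≤ k * (t * (s + 12 * (k * t) + 16) + 1) + 1,
      ∃ C : Circuit (Fin k × Fin n) r, C.eval = sumTest h θ K := by
  have key : ∀ I : Finset (Fin k), Derivable (I.card * (t * (s + 12 * (k * t) + 16) + 1)) ∅
      ({fun x : Fin k × Fin n → Bool => decide (∃ i ∈ I, K ≤ h fun j => x (i, j))} ∪
        levels fun x => ∑ i ∈ I, h fun j => x (i, j)) := by
    intro I
    induction I using Finset.induction_on with
    | empty =>
      refine ((Derivable.const true _).union (.const false _)).mono (by omega) subset_rfl ?_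
      rintro _ (rfl | ⟨j, rfl⟩)
      · simp
      · by_cases hj : j ≤ 0 <;> simp [hj]
    | insert a I ha ih =>
      have hcard : I.card + 1 ≤ k := by
        rw [← Finset.card_insert_of_notMem ha]
        exact (Finset.card_le_univ _).trans_eq (Fintype.card_fin k)
      have hH : ∀ x : Fin k × Fin n → Bool,
          |∑ i ∈ I, h fun j => x (i, j)| ≤ (I.card * t : ℕ) := by
        intro x
        refine (Finset.abs_sum_le_sum_abs _ _).trans ?_
        refine (Finset.sum_le_card_nsmul _ _ (t : ℤ) fun i _ => hh.abs_le _).trans ?_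
        simp
      have h1 := hh.derivable (φ := fun (x : Fin k × Fin n → Bool) j => x (a, j))
        (fun j => ⟨(a, j), fun x => rfl⟩) hH (R := k * t) (by nlinarith)
      have h2 := ih.trans (h1.mono le_rfl (by
        intro f hf; exact Or.inr (Or.inr hf)) subset_rfl)
      have h3 := h2.trans (.or
        (f := fun x => decide (∃ i ∈ I, K ≤ h fun j => x (i, j)))
        (g := fun x => decide (K ≤ h fun j => x (a, j)))
        (by simp) (Or.inr (Or.inr (Or.inl ⟨K, rfl⟩))))
      refine h3.mono ?_ subset_rfl ?_
      · rw [Finset.card_insert_of_notMem ha]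
        apply le_of_eq; ring
      · rintro _ (rfl | ⟨j, rfl⟩)
        · right
          rw [Set.mem_singleton_iff]
          funext x
          rw [Bool.eq_iff_iff]
          simp [or_comm]
        · left; right; right
          refine ⟨j, ?_⟩
          funext x
          simp only [Finset.sum_insert ha, add_comm]
  have h1 := (key Finset.univ).trans (.or
    (f := fun x => decide (θ ≤ ∑ i, h fun j => x (i, j)))
    (g := fun x => decide (∃ i ∈ Finset.univ, K ≤ h fun j => x (i, j)))
    (Or.inr (Or.inr ⟨θ, rfl⟩)) (Or.inr (Or.inl rfl)))
  obtain ⟨r, hr, C, hC⟩ := (h1.mono le_rfl subset_rfl Set.subset_union_right).exists_circuit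
  refine ⟨r, by simpa using hr, C, ?_⟩
  rw [hC]
  funext x
  simp [sumTest]

end Circuits

/-! ### Distributions on finite sets -/

section Finite

variable {α : Type} [Fintype α]

theorem sum_toReal_eq_one (P : PMF α) : ∑ x, (P x).toReal = 1 := by
  have h1 : ∑ y, P y = 1 := by
    rw [← tsum_fintype (L := SummationFilter.unconditional _)]
    exact P.tsum_coe
  rw [← ENNReal.toReal_sum fun x _ => P.apply_ne_top x, h1, ENNReal.toReal_one]

theorem exists_pmf_toReal_eq {q : α → ℝ} (hq : ∀ x, 0 ≤ q x) (h1 : ∑ x, q x = 1) :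
    ∃ P : PMF α, ∀ x, (P x).toReal = q x := by
  refine ⟨PMF.ofFintype (fun x => ENNReal.ofReal (q x)) ?_, fun x => ?_⟩
  · rw [← ENNReal.ofReal_sum_of_nonneg fun x _ => hq x, h1, ENNReal.ofReal_one]
  · rw [PMF.ofFintype_apply, ENNReal.toReal_ofReal (hq x)]

theorem accept_sub_accept (P Q : PMF α) (f : α → Bool) :
    accept P f - accept Q f = ∑ x, if f x then (P x).toReal - (Q x).toReal else 0 := by
  rw [accept, accept, ← Finset.sum_sub_distrib]
  exact Finset.sum_congr rfl fun x _ => by split_ifs <;> simp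

theorem accept_not (P : PMF α) (f : α → Bool) :
    accept P (fun x => !f x) = 1 - accept P f := by
  rw [eq_sub_iff_add_eq, accept, accept, ← Finset.sum_add_distrib, ← sum_toReal_eq_one P]
  exact Finset.sum_congr rfl fun x _ => by cases f x <;> simp

theorem accept_const (P : PMF α) (b : Bool) :
    accept P (fun _ => b) = if b then 1 else 0 := by
  cases b <;> simp [accept, sum_toReal_eq_one]

theorem abs_accept_sub_accept_le_dTV (P Q : PMF α) (f : α → Bool) :
    |accept P f - accept Q f| ≤ dTV P Q := by
  have h1 : ∀ g : α → Bool, accept P g - accept Q g ≤ dTV P Q := by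
    intro g
    have h0 : ∑ x, ((P x).toReal - (Q x).toReal) = 0 := by
      rw [Finset.sum_sub_distrib, sum_toReal_eq_one, sum_toReal_eq_one, sub_self]
    have h2 : dTV P Q
        = ∑ x, ((1 / 2) * |(P x).toReal - (Q x).toReal|
            + (1 / 2) * ((P x).toReal - (Q x).toReal)) := by
      rw [Finset.sum_add_distrib, ← Finset.mul_sum, ← Finset.mul_sum, h0, dTV]
      ring
    rw [accept_sub_accept, h2]
    refine Finset.sum_le_sum fun x _ => ?_
    split_ifs
    · linarith [le_abs_self ((P x).toReal - (Q x).toReal)]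
    · linarith [neg_abs_le ((P x).toReal - (Q x).toReal)]
  rw [abs_le]
  refine ⟨?_, h1 f⟩
  have := h1 fun x => !f x
  rw [accept_not, accept_not] at this
  linarith

/-- A test that is optimal up to the error `e` witnesses the total variation distance. -/
theorem dTV_le_accept_sub_accept {P Q : PMF α} {f : α → Bool} {e : α → ℝ}
    (h1 : ∀ x, 0 ≤ (if f x then (Q x).toReal - (P x).toReal else 0) + e x)
    (h2 : ∀ x, (Q x).toReal - (P x).toReal
      ≤ (if f x then (Q x).toReal - (P x).toReal else 0) + e x) :
    dTV P Q ≤ accept Q f - accept P f + ∑ x, e x := by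
  have h0 : ∑ x, ((Q x).toReal - (P x).toReal) = 0 := by
    rw [Finset.sum_sub_distrib, sum_toReal_eq_one, sum_toReal_eq_one, sub_self]
  have h3 : dTV P Q
      = ∑ x, ((1 / 2) * |(P x).toReal - (Q x).toReal|
          + (1 / 2) * ((Q x).toReal - (P x).toReal)) := by
    rw [Finset.sum_add_distrib, ← Finset.mul_sum, ← Finset.mul_sum, h0, dTV]
    ring
  rw [accept_sub_accept, h3, ← Finset.sum_add_distrib]
  refine Finset.sum_le_sum fun x _ => ?_
  rw [abs_sub_comm]
  rcases abs_cases ((Q x).toReal - (P x).toReal) with ⟨h, -⟩ | ⟨h, -⟩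
  · rw [h]; linarith [h2 x]
  · rw [h]; linarith [h1 x]

theorem dTV_le_accept_decide_le (P Q : PMF α) :
    dTV P Q ≤ accept Q (fun x => decide ((P x).toReal ≤ (Q x).toReal))
      - accept P (fun x => decide ((P x).toReal ≤ (Q x).toReal)) := by
  refine (dTV_le_accept_sub_accept
    (f := fun x => decide ((P x).toReal ≤ (Q x).toReal)) (e := fun _ => 0)
    (fun x => ?_) (fun x => ?_)).trans_eq (by simp)
  · by_cases h : (P x).toReal ≤ (Q x).toReal <;> simp [h]
  · by_cases h : (P x).toReal ≤ (Q x).toReal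
    · simp [h]
    · simpa [h] using (not_le.1 h).le

theorem dTV_le_one (P Q : PMF α) : dTV P Q ≤ 1 := by
  have h : ∑ x, |(P x).toReal - (Q x).toReal| ≤ ∑ x, ((P x).toReal + (Q x).toReal) :=
    Finset.sum_le_sum fun x _ => by
      rw [abs_le]
      constructor <;> linarith [ENNReal.toReal_nonneg (a := P x), ENNReal.toReal_nonneg (a := Q x)]
  rw [Finset.sum_add_distrib, sum_toReal_eq_one, sum_toReal_eq_one] at h
  rw [dTV]
  linarith

/-- Replacing a nonnegative weight `Q` by the distribution proportional to it costs every test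
at most as much as the error of `Q` on the constant test. -/
theorem exists_pmf_normalize (D : PMF α) {Q : α → ℝ} (hQ : ∀ x, 0 ≤ Q x) {δ : ℝ} (hδ : δ < 1)
    (h1 : |∑ x, ((D x).toReal - Q x)| ≤ δ) :
    0 < ∑ x, Q x ∧ ∃ P : PMF α, (∀ x, (P x).toReal = Q x / ∑ y, Q y) ∧
      ∀ f : α → Bool, |∑ x, if f x then (D x).toReal - Q x else 0| ≤ δ →
        |accept D f - accept P f| ≤ 2 * δ := by
  set m := ∑ x, Q x with hm
  rw [Finset.sum_sub_distrib, sum_toReal_eq_one, ← hm] at h1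
  have hm0 : 0 < m := by linarith [le_abs_self (1 - m)]
  obtain ⟨P, hP⟩ := exists_pmf_toReal_eq (q := fun x => Q x / m)
    (fun x => div_nonneg (hQ x) hm0.le) (by rw [← Finset.sum_div, ← hm, div_self hm0.ne'])
  refine ⟨hm0, P, hP, fun f hf => ?_⟩
  have h2 : accept D f - accept P f
      = (∑ x, if f x then (D x).toReal - Q x else 0) - (1 - m) * accept P f := by
    rw [accept_sub_accept, accept, Finset.mul_sum, ← Finset.sum_sub_distrib]
    refine Finset.sum_congr rfl fun x _ => ?_
    split_ifs
    · rw [hP]; field_simp; ring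
    · simp
  have h3 : 0 ≤ accept P f ∧ accept P f ≤ 1 := by
    constructor
    · exact Finset.sum_nonneg fun x _ => by split_ifs <;> simp
    · rw [← sum_toReal_eq_one P]
      exact Finset.sum_le_sum fun x _ => by split_ifs <;> simp
  rw [h2]
  refine (abs_sub _ _).trans ?_
  rw [abs_mul, abs_of_nonneg h3.1]
  nlinarith [abs_nonneg (1 - m)]

end Finite

/-! ### Circuit distance -/

section CircuitDistance

variable {ι : Type} [Fintype ι] [DecidableEq ι]

/-- The circuit without gates that accepts every input. -/
def Circuit.one (ι : Type) : Circuit ι 0 := ⟨.nil, .const true⟩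

@[simp]
theorem Circuit.eval_one {ι : Type} (x : ι → Bool) : (Circuit.one ι).eval x = true := rfl

theorem le_dCirc {s t : ℕ} (ht : t ≤ s) (C : Circuit ι t) (P Q : PMF (ι → Bool)) :
    |accept P C.eval - accept Q C.eval| ≤ dCirc s P Q :=
  le_csSup ⟨1, by
    rintro _ ⟨t, -, c, rfl⟩
    exact (abs_accept_sub_accept_le_dTV P Q _).trans (dTV_le_one P Q)⟩ ⟨t, ht, C, rfl⟩

theorem dCirc_le {s : ℕ} {P Q : PMF (ι → Bool)} {a : ℝ}
    (h : ∀ t ≤ s, ∀ C : Circuit ι t, |accept P C.eval - accept Q C.eval| ≤ a) :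
    dCirc s P Q ≤ a := by
  refine csSup_le ⟨_, 0, Nat.zero_le s, .one ι, rfl⟩ ?_
  rintro _ ⟨t, ht, C, rfl⟩
  exact h t ht C

theorem dCirc_self (s : ℕ) (P : PMF (ι → Bool)) : dCirc s P P ≤ 0 :=
  dCirc_le fun t _ C => by simp

theorem dCirc_nonneg (s : ℕ) (P Q : PMF (ι → Bool)) : 0 ≤ dCirc s P Q :=
  (abs_nonneg _).trans (le_dCirc (Nat.zero_le s) (.one ι) P Q)

theorem dCirc_le_dTV (s : ℕ) (P Q : PMF (ι → Bool)) : dCirc s P Q ≤ dTV P Q :=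
  dCirc_le fun _ _ _ => abs_accept_sub_accept_le_dTV P Q _

end CircuitDistance

/-! ### The hybrid argument -/

/-- The hybrid argument for the `k`-fold powers of two weights: `T` may be any real function whose
restrictions to one coordinate, the others being fixed, differ in mean by at most `δ`. -/
theorem abs_sum_prod_sub_sum_prod_le {X : Type} [Fintype X] {p q : X → ℝ}
    (hp : ∀ x, 0 ≤ p x) (hp1 : ∑ x, p x = 1) (hq : ∀ x, 0 ≤ q x) (hq1 : ∑ x, q x = 1) {δ : ℝ}
    (k : ℕ) (T : (Fin k → X) → ℝ)
    (hT : ∀ i z, |∑ y, (p y - q y) * T (Function.update z i y)| ≤ δ) :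
    |∑ z, (∏ i, p (z i)) * T z - ∑ z, (∏ i, q (z i)) * T z| ≤ k * δ := by
  induction k with
  | zero => simp
  | succ k ih =>
    have split : ∀ r : X → ℝ, ∑ z : Fin (k + 1) → X, (∏ i, r (z i)) * T z
        = ∑ x, ∑ z : Fin k → X, r x * (∏ i, r (z i)) * T (Fin.cons x z) := by
      intro r
      rw [← (Fin.consEquiv fun _ => X).sum_comp, Fintype.sum_prod_type]
      simp [Fin.consEquiv, Fin.prod_univ_succ]
    have h1 : ∀ x, |∑ z : Fin k → X, (∏ i, p (z i)) * T (Fin.cons x z)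
        - ∑ z : Fin k → X, (∏ i, q (z i)) * T (Fin.cons x z)| ≤ k * δ := by
      intro x
      refine ih (fun z => T (Fin.cons x z)) fun i z => ?_
      have := hT i.succ (Fin.cons x z)
      simpa only [← Fin.cons_update] using this
    have h2 : ∀ z : Fin k → X, |∑ x, (p x - q x) * T (Fin.cons x z)| ≤ δ := by
      intro z
      rcases isEmpty_or_nonempty X with hX | ⟨⟨x₀⟩⟩
      · simp at hp1
      · simpa [Fin.update_cons_zero] using hT 0 (Fin.cons x₀ z)
    have hqk : ∑ z : Fin k → X, ∏ i, q (z i) = 1 := by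
      rw [← Fintype.piFinset_univ, ← Finset.prod_univ_sum]
      simp [hq1]
    have h3 : ∑ z, (∏ i, p (z i)) * T z - ∑ z, (∏ i, q (z i)) * T z
        = ∑ x, p x * (∑ z : Fin k → X, (∏ i, p (z i)) * T (Fin.cons x z)
            - ∑ z : Fin k → X, (∏ i, q (z i)) * T (Fin.cons x z))
          + ∑ z : Fin k → X, (∏ i, q (z i)) * ∑ x, (p x - q x) * T (Fin.cons x z) := by
      have h4 : ∑ z : Fin k → X, (∏ i, q (z i)) * ∑ x, (p x - q x) * T (Fin.cons x z)
          = ∑ x, ∑ z : Fin k → X, (∏ i, q (z i)) * ((p x - q x) * T (Fin.cons x z)) := by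
        rw [Finset.sum_comm]
        simp only [Finset.mul_sum]
      rw [split, split, h4, ← Finset.sum_sub_distrib, ← Finset.sum_add_distrib]
      refine Finset.sum_congr rfl fun x _ => ?_
      rw [mul_sub, Finset.mul_sum, Finset.mul_sum, ← Finset.sum_sub_distrib,
        ← Finset.sum_sub_distrib, ← Finset.sum_add_distrib]
      exact Finset.sum_congr rfl fun z _ => by ring
    have weighted : ∀ {Y : Type} [Fintype Y] (w u : Y → ℝ) (c : ℝ), (∀ y, 0 ≤ w y) →
        ∑ y, w y = 1 → (∀ y, |u y| ≤ c) → |∑ y, w y * u y| ≤ c := by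
      intro Y _ w u c hw hw1 hu
      calc |∑ y, w y * u y| ≤ ∑ y, |w y * u y| := Finset.abs_sum_le_sum_abs _ _
        _ ≤ ∑ y, w y * c := Finset.sum_le_sum fun y _ => by
            rw [abs_mul, abs_of_nonneg (hw y)]
            exact mul_le_mul_of_nonneg_left (hu y) (hw y)
        _ = c := by rw [← Finset.sum_mul, hw1, one_mul]
    rw [h3]
    refine (abs_add_le _ _).trans ?_
    push_cast
    have h5 := weighted p _ _ hp hp1 h1
    have h6 := weighted _ _ _ (fun z : Fin k → X => Finset.prod_nonneg fun i _ => hq (z i)) hqk h2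
    linarith

section Iid

variable {n k : ℕ}

theorem iid_toReal (D : PMF (Fin n → Bool)) (x : Fin k × Fin n → Bool) :
    (iid D k x).toReal = ∏ i, (D fun j => x (i, j)).toReal := by
  rw [iid, PMF.ofFintype_apply, ENNReal.toReal_prod]

theorem accept_iid (D : PMF (Fin n → Bool)) (T : (Fin k × Fin n → Bool) → Bool) :
    accept (iid D k) T
      = ∑ z : Fin k → Fin n → Bool, (∏ i, (D (z i)).toReal)
          * if T (fun q => z q.1 q.2) then 1 else 0 := by
  rw [accept, ← (Equiv.curry (Fin k) (Fin n) Bool).symm.sum_comp]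
  refine Finset.sum_congr rfl fun z _ => ?_
  rw [iid_toReal]
  have : (Equiv.curry (Fin k) (Fin n) Bool).symm z = fun q => z q.1 q.2 := rfl
  rw [this]
  simp

/-- Passing from `P` to `Q` one sample at a time: a test on `k` samples tells the two apart at
most `k` times as well as its restrictions to a single sample do. -/
theorem abs_accept_iid_sub_le (P Q : PMF (Fin n → Bool)) (T : (Fin k × Fin n → Bool) → Bool)
    {δ : ℝ}
    (hT : ∀ (i : Fin k) (x : Fin k × Fin n → Bool),
      |accept P (fun y => T fun q => if q.1 = i then y q.2 else x q)
        - accept Q (fun y => T fun q => if q.1 = i then y q.2 else x q)| ≤ δ) :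
    |accept (iid P k) T - accept (iid Q k) T| ≤ k * δ := by
  rw [accept_iid, accept_iid]
  refine abs_sum_prod_sub_sum_prod_le (p := fun x => (P x).toReal) (q := fun x => (Q x).toReal)
    (fun _ => ENNReal.toReal_nonneg) (sum_toReal_eq_one P) (fun _ => ENNReal.toReal_nonneg)
    (sum_toReal_eq_one Q) k (fun z => if T (fun q => z q.1 q.2) then 1 else 0) fun i z => ?_
  refine le_of_eq_of_le ?_ (hT i fun q => z q.1 q.2)
  rw [accept_sub_accept]
  congr 1
  refine Finset.sum_congr rfl fun y _ => ?_
  have : (fun q : Fin k × Fin n => Function.update z i y q.1 q.2)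
      = fun q => if q.1 = i then y q.2 else z q.1 q.2 := by
    funext q
    by_cases h : q.1 = i <;> simp [h]
  rw [this]
  simp

theorem dTV_iid_le (P Q : PMF (Fin n → Bool)) : dTV (iid P k) (iid Q k) ≤ k * dTV P Q := by
  refine (dTV_le_accept_decide_le _ _).trans ((le_abs_self _).trans ?_)
  rw [abs_sub_comm]
  exact abs_accept_iid_sub_le P Q _ fun i x => abs_accept_sub_accept_le_dTV P Q _

variable {ι κ : Type}

/-- Replaces every input bit by an input bit or a constant. -/
def Source.subst (ρ : ι → κ ⊕ Bool) {s : ℕ} : Source ι s → Source κ s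
  | .const b => .const b
  | .input i => Sum.elim .input .const (ρ i)
  | .gate j => .gate j

/-- Replaces every input bit by an input bit or a constant. -/
def Gate.subst (ρ : ι → κ ⊕ Bool) {s : ℕ} : Gate ι s → Gate κ s
  | .not a => .not (a.subst ρ)
  | .and a b => .and (a.subst ρ) (b.subst ρ)
  | .or a b => .or (a.subst ρ) (b.subst ρ)

/-- Replaces every input bit by an input bit or a constant. -/
def GateSeq.subst (ρ : ι → κ ⊕ Bool) : {s : ℕ} → GateSeq ι s → GateSeq κ s
  | _, .nil => .nil
  | _, .snoc c g => .snoc (c.subst ρ) (g.subst ρ)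

theorem Source.eval_subst (ρ : ι → κ ⊕ Bool) (y : κ → Bool) {s : ℕ} (v : Fin s → Bool)
    (a : Source ι s) : (a.subst ρ).eval y v = a.eval (fun i => Sum.elim y id (ρ i)) v := by
  rcases a with b | i | j
  · rfl
  · rcases h : ρ i <;> simp [Source.subst, Source.eval, h]
  · rfl

theorem Gate.eval_subst (ρ : ι → κ ⊕ Bool) (y : κ → Bool) {s : ℕ} (v : Fin s → Bool)
    (g : Gate ι s) : (g.subst ρ).eval y v = g.eval (fun i => Sum.elim y id (ρ i)) v := by
  cases g <;> simp [Gate.subst, Gate.eval, Source.eval_subst]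

theorem GateSeq.eval_subst (ρ : ι → κ ⊕ Bool) (y : κ → Bool) {s : ℕ} (c : GateSeq ι s) :
    (c.subst ρ).eval y = c.eval (fun i => Sum.elim y id (ρ i)) := by
  induction c with
  | nil => rfl
  | snoc c g ih => simp only [GateSeq.subst, GateSeq.eval, ih, Gate.eval_subst]

theorem Circuit.exists_subst (ρ : ι → κ ⊕ Bool) {s : ℕ} (C : Circuit ι s) :
    ∃ C' : Circuit κ s, ∀ y, C'.eval y = C.eval (fun i => Sum.elim y id (ρ i)) :=
  ⟨⟨C.gates.subst ρ, C.output.subst ρ⟩, fun y => by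
    simp only [Circuit.eval, GateSeq.eval_subst, Source.eval_subst]⟩

theorem dCirc_iid_le (s : ℕ) (P Q : PMF (Fin n → Bool)) :
    dCirc s (iid P k) (iid Q k) ≤ k * dCirc s P Q := by
  refine dCirc_le fun t ht C => abs_accept_iid_sub_le P Q _ fun i x => ?_
  obtain ⟨C', hC'⟩ := C.exists_subst
    fun q : Fin k × Fin n => if q.1 = i then Sum.inl q.2 else Sum.inr (x q)
  convert le_dCirc ht C' P Q using 4 <;>
  · funext y
    rw [hC']
    congr 1
    funext q
    split_ifs <;> rfl

/-- Proxies that no small circuit can tell from the given distributions are, jointly for `k`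
samples, at least as far apart as small circuits can tell the given ones apart. -/
theorem dCirc_iid_sub_le_dTV_iid (s : ℕ) (D₀ D₁ P₀ P₁ : PMF (Fin n → Bool)) :
    dCirc s (iid D₀ k) (iid D₁ k) - k * (dCirc s D₀ P₀ + dCirc s D₁ P₁)
      ≤ dTV (iid P₀ k) (iid P₁ k) := by
  rw [sub_le_iff_le_add]
  refine dCirc_le fun t ht C => ?_
  have h0 := (le_dCirc ht C (iid D₀ k) (iid P₀ k)).trans (dCirc_iid_le s D₀ P₀)
  have h1 := (le_dCirc ht C (iid D₁ k) (iid P₁ k)).trans (dCirc_iid_le s D₁ P₁)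
  have h2 := abs_accept_sub_accept_le_dTV (iid P₀ k) (iid P₁ k) C.eval
  rw [abs_le] at *
  constructor <;> linarith

end Iid

/-! ### Boosting -/

theorem exp_sub_one_le_add_sq {d : ℝ} (hd : |d| ≤ 1) : Real.exp d - 1 ≤ d + d ^ 2 := by
  have := Real.abs_exp_sub_one_sub_id_le hd
  linarith [le_abs_self (Real.exp d - 1 - d)]

section Boost

variable {ι : Type} [Fintype ι] [DecidableEq ι]

/-- The potential of a level function `h` at scale `η`. With `ρ` in the role of the derivative of
`ψ`, its gradient in the direction of `h x` is `-η` times the residual `b x - α x * ρ (η * h x)`. -/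
def potential (α b : (ι → Bool) → ℝ) (ψ : ℝ → ℝ) (η : ℝ) (h : (ι → Bool) → ℤ) : ℝ :=
  ∑ x, (α x * ψ (η * h x) - b x * (η * h x))

/-- One step: if the residual `b - α * ρ (η * h)` correlates with the test `e`, then moving `h`
by one on the accepted set, in the direction of the correlation, lowers the potential. -/
theorem exists_potential_step {α b : (ι → Bool) → ℝ} (hα : ∀ x, 0 ≤ α x) (hb : ∀ x, 0 ≤ b x)
    (hb1 : ∑ x, b x = 1) {ψ ρ : ℝ → ℝ} (hρ : ∀ y, 0 ≤ ρ y)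
    (hψ : ∀ y d, ψ (y + d) ≤ ψ y + ρ y * (Real.exp d - 1)) {δ : ℝ} (hδ : 0 < δ) (hδ1 : δ ≤ 1)
    (h : (ι → Bool) → ℤ) (e : (ι → Bool) → Bool)
    (he : δ < |∑ x, if e x then b x - α x * ρ (δ / 4 * h x) else 0|) :
    ∃ σ : ℤ, |σ| = 1 ∧ potential α b ψ (δ / 4) (fun x => h x + if e x then σ else 0)
      ≤ potential α b ψ (δ / 4) h - δ ^ 2 / 8 := by
  set η := δ / 4 with hη
  set A := ∑ x, if e x then b x - α x * ρ (η * h x) else 0 with hA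
  set W := ∑ x, if e x then α x * ρ (η * h x) else 0 with hW
  have hWA : W ≤ 1 + |A| := by
    have h1 : W + A = ∑ x, if e x then b x else 0 := by
      rw [hW, hA, ← Finset.sum_add_distrib]
      exact Finset.sum_congr rfl fun x _ => by split_ifs <;> ring
    have h2 : (∑ x, if e x then b x else 0) ≤ 1 := by
      rw [← hb1]
      exact Finset.sum_le_sum fun x _ => by split_ifs <;> simp [hb]
    linarith [neg_abs_le A]
  have step : ∀ σ : ℤ, |σ| = 1 → potential α b ψ η (fun x => h x + if e x then σ else 0)
      ≤ potential α b ψ η h - η * (σ * A) + η ^ 2 * W := by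
    intro σ hσ
    have hσr : |(σ : ℝ)| = 1 := by exact_mod_cast congrArg (Int.cast (R := ℝ)) hσ
    rw [potential, potential, hA, hW, Finset.mul_sum, Finset.mul_sum, Finset.mul_sum,
      ← Finset.sum_sub_distrib, ← Finset.sum_add_distrib]
    refine Finset.sum_le_sum fun x _ => ?_
    split_ifs with hx
    · have h1 := hψ (η * h x) (η * σ)
      have h2 : Real.exp (η * σ) - 1 ≤ η * σ + η ^ 2 := by
        have := exp_sub_one_le_add_sq (d := η * σ) (by
          rw [abs_mul, hσr, abs_of_pos (by positivity)]; linarith)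
        rwa [mul_pow, ← sq_abs (σ : ℝ), hσr, one_pow, mul_one] at this
      have h3 : ψ (η * ↑(h x + σ)) ≤ ψ (η * h x) + ρ (η * h x) * (η * σ + η ^ 2) := by
        push_cast
        rw [mul_add]
        exact h1.trans (by linarith [mul_le_mul_of_nonneg_left h2 (hρ (η * h x))])
      have h4 := mul_le_mul_of_nonneg_left h3 (hα x)
      push_cast at h4 ⊢
      linarith
    · simp
  have fin : ∀ σ : ℤ, |σ| = 1 → σ * A = |A| →
      potential α b ψ η (fun x => h x + if e x then σ else 0)
        ≤ potential α b ψ η h - δ ^ 2 / 8 := by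
    intro σ hσ hσA
    have h1 := step σ hσ
    rw [hσA] at h1
    have h2 : η ^ 2 * W ≤ η ^ 2 * (1 + |A|) := mul_le_mul_of_nonneg_left hWA (sq_nonneg _)
    have h3 : (η - η ^ 2) * δ ≤ (η - η ^ 2) * |A| :=
      mul_le_mul_of_nonneg_left he.le (by nlinarith)
    have h4 : δ ^ 2 / 8 ≤ (η - η ^ 2) * δ - η ^ 2 := by
      rw [hη]; nlinarith [mul_nonneg (sq_nonneg δ) (sub_nonneg.2 hδ1)]
    linarith
  rcases le_total 0 A with h0 | h0
  · exact ⟨1, by simp, fin 1 (by simp) (by simp [abs_of_nonneg h0])⟩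
  · exact ⟨-1, by simp, fin (-1) (by simp) (by simp [abs_of_nonpos h0])⟩

/-- Boosting with levels frozen once they reach `K`: after few steps the weight that equals
`α * ρ (η * h)` below level `K` and `b` on the frozen set agrees with `b` on all tests
`{x | C x = 1, h x < j}`, with `C` a circuit of size at most `s`. -/
theorem exists_boost (s : ℕ) {α b : (ι → Bool) → ℝ} (hα : ∀ x, 0 ≤ α x) (hb : ∀ x, 0 ≤ b x)
    (hb1 : ∑ x, b x = 1) {ψ ρ : ℝ → ℝ} (hρ : ∀ y, 0 ≤ ρ y)
    (hψ : ∀ y d, ψ (y + d) ≤ ψ y + ρ y * (Real.exp d - 1)) {δ : ℝ} (hδ : 0 < δ) (hδ1 : δ ≤ 1)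
    {K : ℤ} (hK : 0 ≤ K) {B : ℝ}
    (hB : ∀ h : (ι → Bool) → ℤ, (∀ x, h x ≤ K) → -B ≤ potential α b ψ (δ / 4) h) :
    ∃ (t : ℕ) (h : (ι → Bool) → ℤ), BoostSteps ι s t h ∧ (∀ x, h x ≤ K) ∧
      t * (δ ^ 2 / 8) ≤ (∑ x, α x) * ψ 0 + B ∧
      potential α b ψ (δ / 4) h ≤ (∑ x, α x) * ψ 0 ∧
      ∀ r ≤ s, ∀ (C : Circuit ι r) (j : ℤ),
        |∑ x, if C.eval x && decide (h x < j) then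
          b x - (if h x < K then α x * ρ (δ / 4 * h x) else b x) else 0| ≤ δ := by
  set L := (∑ x, α x) * ψ 0 with hL
  have hδ2 : 0 < δ ^ 2 / 8 := by positivity
  let good : ((ι → Bool) → ℤ) → Prop := fun h => ∀ r ≤ s, ∀ (C : Circuit ι r) (j : ℤ),
        |∑ x, if C.eval x && decide (h x < j) then
          b x - (if h x < K then α x * ρ (δ / 4 * h x) else b x) else 0| ≤ δ
  let reach : ℕ → ((ι → Bool) → ℤ) → Prop := fun t h =>
    BoostSteps ι s t h ∧ (∀ x, h x ≤ K) ∧ potential α b ψ (δ / 4) h ≤ L - t * (δ ^ 2 / 8)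
  have bound : ∀ t h, reach t h → t * (δ ^ 2 / 8) ≤ L + B := by
    rintro t h ⟨-, h2, h3⟩
    linarith [hB h h2]
  by_contra hcon
  have next : ∀ t h, reach t h → ∃ h', reach (t + 1) h' := by
    intro t h hh
    obtain ⟨h1, h2, h3⟩ := hh
    have hbad : ¬ good h := fun hg =>
      hcon ⟨t, h, h1, h2, bound t h ⟨h1, h2, h3⟩,
        h3.trans (sub_le_self _ (by positivity)), hg⟩
    simp only [good, not_forall, not_le] at hbad
    obtain ⟨r, hr, C, j, hCj⟩ := hbad
    -- frozen points have zero residual, so the test may be restricted to levels below `K`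
    have hsum : (∑ x, if C.eval x && decide (h x < j) then
          b x - (if h x < K then α x * ρ (δ / 4 * h x) else b x) else 0)
        = ∑ x, if C.eval x && decide (h x < min j K) then
          b x - α x * ρ (δ / 4 * h x) else 0 := by
      refine Finset.sum_congr rfl fun x _ => ?_
      by_cases hK : h x < K <;> simp [hK]
    rw [hsum] at hCj
    obtain ⟨σ, hσ, hpot⟩ := exists_potential_step hα hb hb1 hρ hψ hδ hδ1 h
      (fun x => C.eval x && decide (h x < min j K)) hCj
    refine ⟨_, h1.step hr C (min j K) hσ, fun x => ?_, hpot.trans ?_⟩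
    · have := (abs_le.1 hσ.le).2
      have := h2 x
      split_ifs with hx
      · simp only [Bool.and_eq_true, decide_eq_true_eq, lt_min_iff] at hx
        omega
      · omega
    · push_cast; linarith
  have all : ∀ t, ∃ h, reach t h := by
    intro t
    induction t with
    | zero =>
      refine ⟨fun _ => 0, .zero, fun _ => hK, ?_⟩
      simp [potential, hL, Finset.sum_mul]
    | succ t ih => exact next t _ ih.choose_spec
  obtain ⟨t, ht⟩ := exists_nat_gt ((L + B) / (δ ^ 2 / 8))
  rw [div_lt_iff₀ hδ2] at ht
  obtain ⟨h, hh⟩ := all t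
  linarith [bound t h hh]

/-- The tests covered by boosting include the circuits, the thresholds and the constant test. -/
theorem bounds_of_joint_tests {s : ℕ} {h : (ι → Bool) → ℤ} {K : ℤ} (hK : ∀ x, h x ≤ K)
    {u : (ι → Bool) → ℝ} {δ : ℝ}
    (hu : ∀ r ≤ s, ∀ (C : Circuit ι r) (j : ℤ),
      |∑ x, if C.eval x && decide (h x < j) then u x else 0| ≤ δ) :
    (∀ r ≤ s, ∀ C : Circuit ι r, |∑ x, if C.eval x then u x else 0| ≤ δ) ∧
      (∀ j : ℤ, |∑ x, if decide (h x < j) then u x else 0| ≤ δ) ∧ |∑ x, u x| ≤ δ := by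
  refine ⟨fun r hr C => ?_, fun j => ?_, ?_⟩
  · simpa [Int.lt_add_one_iff, hK] using hu r hr C (K + 1)
  · simpa using hu 0 (Nat.zero_le s) (.one ι) j
  · simpa [Int.lt_add_one_iff, hK] using hu 0 (Nat.zero_le s) (.one ι) (K + 1)

end Boost

/-! ### Likelihood-ratio tests on independent samples -/

section LikelihoodRatio

variable {n k : ℕ}

/-- Restricted to one sample, `sumTest h θ K` is a threshold of `h`, or constant. So a
distribution that is accurate on the thresholds of `h` is accurate on `sumTest h θ K`. -/
theorem abs_accept_iid_sumTest_sub_le (P Q : PMF (Fin n → Bool)) (h : (Fin n → Bool) → ℤ)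
    (θ K : ℤ) {δ : ℝ}
    (hδ : ∀ j : ℤ, |accept P (fun x => decide (h x < j)) - accept Q (fun x => decide (h x < j))|
      ≤ δ) :
    |accept (iid P k) (sumTest h θ K) - accept (iid Q k) (sumTest h θ K)| ≤ k * δ := by
  classical
  refine abs_accept_iid_sub_le P Q _ fun i x => ?_
  have hrestrict : ∀ y : Fin n → Bool,
      sumTest h θ K (fun q => if q.1 = i then y q.2 else x q)
        = (decide (∃ a, a ≠ i ∧ K ≤ h fun j => x (a, j)) ||
          !decide (h y < min (θ - ∑ a ∈ Finset.univ.erase i, h fun j => x (a, j)) K)) := by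
    intro y
    have h1 : ∀ a, (h fun j => if a = i then y j else x (a, j))
        = if a = i then h y else h fun j => x (a, j) := by
      intro a; split_ifs <;> rfl
    have h2 : ∑ a, (if a = i then h y else h fun j => x (a, j))
        = h y + ∑ a ∈ Finset.univ.erase i, h fun j => x (a, j) := by
      rw [← Finset.add_sum_erase _ _ (Finset.mem_univ i), if_pos rfl]
      congr 1
      exact Finset.sum_congr rfl fun a ha => if_neg (Finset.ne_of_mem_erase ha)
    have h3 : (∃ a, K ≤ if a = i then h y else h fun j => x (a, j))
        ↔ (K ≤ h y ∨ ∃ a, a ≠ i ∧ K ≤ h fun j => x (a, j)) := by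
      constructor
      · rintro ⟨a, ha⟩
        by_cases hai : a = i
        · exact Or.inl (by simpa [hai] using ha)
        · exact Or.inr ⟨a, hai, by simpa [hai] using ha⟩
      · rintro (ha | ⟨a, hai, ha⟩)
        · exact ⟨i, by simpa using ha⟩
        · exact ⟨a, by simpa [hai] using ha⟩
    simp only [sumTest, h1, h2, h3]
    rw [Bool.eq_iff_iff]
    simp only [Bool.or_eq_true, decide_eq_true_eq, Bool.not_eq_true', decide_eq_false_iff_not,
      not_lt, min_le_iff, sub_le_iff_le_add]
    rw [← or_assoc, or_comm]
  simp only [hrestrict]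
  by_cases hx : ∃ a, a ≠ i ∧ K ≤ h fun j => x (a, j)
  · simp only [hx, decide_true, Bool.true_or, accept_const]
    simpa using (abs_nonneg _).trans (hδ 0)
  · simp only [hx, decide_false, Bool.false_or, accept_not]
    rw [sub_sub_sub_cancel_left, abs_sub_comm]
    exact hδ _

theorem accept_iid_exists_le (P : PMF (Fin n → Bool)) (f : (Fin n → Bool) → Bool) :
    accept (iid P k) (fun x => decide (∃ i, f (fun j => x (i, j)) = true)) ≤ k * accept P f := by
  have h1 : accept (iid P k) (fun x => !decide (∃ i, f (fun j => x (i, j)) = true))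
      = (accept P fun y => !f y) ^ k := by
    have h2 : (accept P fun y => !f y) ^ k
        = ∑ z : Fin k → Fin n → Bool, ∏ i, if !f (z i) then (P (z i)).toReal else 0 := by
      rw [← Fintype.piFinset_univ, Finset.sum_prod_piFinset Finset.univ
        fun (_ : Fin k) y => if !f y then (P y).toReal else 0]
      simp [accept]
    rw [accept_iid, h2]
    refine Finset.sum_congr rfl fun z _ => ?_
    by_cases hz : ∃ i, f (z i) = true
    · obtain ⟨i, hi⟩ := hz
      have h3 : ∃ i, f (z i) = true := ⟨i, hi⟩
      have h4 : (∏ i, if !f (z i) then (P (z i)).toReal else 0) = 0 :=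
        Finset.prod_eq_zero (Finset.mem_univ i) (by simp [hi])
      rw [h4]
      simp [h3]
    · simp only [not_exists, Bool.not_eq_true] at hz
      simp [hz]
  rw [accept_not, accept_not] at h1
  have h2 : accept P f ≤ 1 := by
    rw [← sum_toReal_eq_one P]
    exact Finset.sum_le_sum fun x _ => by split_ifs <;> simp
  have h3 := one_add_mul_le_pow (a := -accept P f) (by linarith) k
  rw [← sub_eq_add_neg] at h3
  linarith

/-- If the density of `P₁` with respect to `P₀` is proportional to `exp (η * h)` where `h < K`,
then a test of the form `sumTest h θ K` is optimal for `k` samples, up to the probability that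
`P₀` produces a sample with `h ≥ K`. -/
theorem exists_dTV_iid_le_sumTest {P₀ P₁ : PMF (Fin n → Bool)} {h : (Fin n → Bool) → ℤ} {K : ℤ}
    {η c : ℝ} (hη : 0 < η) (hc : 0 < c)
    (hP : ∀ y, h y < K → (P₁ y).toReal = (P₀ y).toReal * (Real.exp (η * h y) * c)) :
    ∃ θ : ℤ, dTV (iid P₀ k) (iid P₁ k)
      ≤ accept (iid P₁ k) (sumTest h θ K) - accept (iid P₀ k) (sumTest h θ K)
        + k * accept P₀ (fun y => decide (K ≤ h y)) := by
  -- `∑ i, h (x i) ≥ θ` says that the likelihood ratio `exp (η * ∑ i, h (x i)) * c ^ k` is at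
  -- least `1`
  set θ : ℤ := ⌈-(k * Real.log c) / η⌉ with hθ
  refine ⟨θ, ?_⟩
  have hratio : ∀ S : ℤ, θ ≤ S ↔ 1 ≤ Real.exp (η * S) * c ^ k := by
    intro S
    have h1 : Real.exp (η * S) * c ^ k = Real.exp (η * S + k * Real.log c) := by
      rw [Real.exp_add, Real.exp_nat_mul, Real.exp_log hc]
    rw [h1, Real.one_le_exp_iff, hθ, Int.ceil_le, div_le_iff₀ hη]
    constructor <;> intro h <;> linarith
  have hprod : ∀ x : Fin k × Fin n → Bool, (¬ ∃ i, K ≤ h fun j => x (i, j)) →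
      (iid P₁ k x).toReal = (iid P₀ k x).toReal
        * (Real.exp (η * (∑ i, h fun j => x (i, j) : ℤ)) * c ^ k) := by
    intro x hx
    simp only [not_exists, not_le] at hx
    rw [iid_toReal, iid_toReal, Finset.prod_congr rfl fun i _ => hP _ (hx i),
      Finset.prod_mul_distrib, Finset.prod_mul_distrib, ← Real.exp_sum, ← Finset.mul_sum]
    simp
  refine (dTV_le_accept_sub_accept (f := sumTest h θ K)
    (e := fun x => if (∃ i, K ≤ h fun j => x (i, j)) then (iid P₀ k x).toReal else 0)
    (fun x => ?_) (fun x => ?_)).trans (add_le_add le_rfl ?_)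
  · by_cases hx : ∃ i, K ≤ h fun j => x (i, j)
    · simp only [sumTest, hx, decide_true, Bool.or_true, if_true]
      linarith [ENNReal.toReal_nonneg (a := iid P₁ k x)]
    · simp only [sumTest, hx, decide_false, Bool.or_false, if_false, add_zero, decide_eq_true_eq]
      split_ifs with hS
      · rw [hprod x hx, ← mul_sub_one]
        exact mul_nonneg ENNReal.toReal_nonneg (sub_nonneg.2 ((hratio _).1 hS))
      · exact le_rfl
  · by_cases hx : ∃ i, K ≤ h fun j => x (i, j)
    · simp only [sumTest, hx, decide_true, Bool.or_true, if_true]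
      linarith [ENNReal.toReal_nonneg (a := iid P₀ k x)]
    · simp only [sumTest, hx, decide_false, Bool.or_false, if_false, add_zero, decide_eq_true_eq]
      split_ifs with hS
      · exact le_rfl
      · rw [hprod x hx, ← mul_sub_one]
        exact mul_nonpos_of_nonneg_of_nonpos ENNReal.toReal_nonneg
          (sub_nonpos.2 (not_le.1 fun h1 => hS ((hratio _).2 h1)).le)
  · refine le_trans (le_of_eq ?_) (accept_iid_exists_le P₀ fun y => decide (K ≤ h y))
    rw [accept]
    refine Finset.sum_congr rfl fun x _ => ?_
    simp only [decide_eq_true_eq]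

end LikelihoodRatio

/-! ### Proxies -/

section Proxies

variable {n : ℕ}

/-- If the proxies agree with the given distributions on thresholds of a boosted level function
`h`, and `sumTest h θ K` is nearly optimal for telling their `k`-fold products apart, then the
circuit that computes this test tells apart the products of the given distributions. -/
theorem BoostSteps.dTV_iid_le_dCirc_iid {s t k s' : ℕ} {h : (Fin n → Bool) → ℤ}
    (hh : BoostSteps (Fin n) s t h) (hs' : k * (t * (s + 12 * (k * t) + 16) + 1) + 1 ≤ s')
    {D₀ D₁ P₀ P₁ : PMF (Fin n → Bool)} {θ K : ℤ} {δ₀ δ₁ γ ε : ℝ}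
    (h0 : ∀ j : ℤ, |accept D₀ (fun x => decide (h x < j))
      - accept P₀ (fun x => decide (h x < j))| ≤ δ₀)
    (h1 : ∀ j : ℤ, |accept D₁ (fun x => decide (h x < j))
      - accept P₁ (fun x => decide (h x < j))| ≤ δ₁)
    (hTV : dTV (iid P₀ k) (iid P₁ k)
      ≤ accept (iid P₁ k) (sumTest h θ K) - accept (iid P₀ k) (sumTest h θ K) + k * γ)
    (hε : δ₀ + δ₁ + γ ≤ ε) :
    dTV (iid P₀ k) (iid P₁ k) ≤ dCirc s' (iid D₀ k) (iid D₁ k) + k * ε := by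
  obtain ⟨r, hr, C, hC⟩ := hh.exists_circuit_sumTest (k := k) θ K
  have h2 := le_dCirc (hr.trans hs') C (iid D₀ k) (iid D₁ k)
  rw [hC] at h2
  have h3 := abs_accept_iid_sumTest_sub_le (k := k) D₀ P₀ h θ K h0
  have h4 := abs_accept_iid_sumTest_sub_le (k := k) D₁ P₁ h θ K h1
  have h5 := mul_le_mul_of_nonneg_left hε (Nat.cast_nonneg (α := ℝ) k)
  rw [mul_add, mul_add] at h5
  rw [_root_.abs_le] at h2 h3 h4
  linarith [h2.1, h3.2, h4.1]

/-- The condition `ψ (y + d) ≤ ψ y + ρ y * (exp d - 1)` of boosting for the logistic loss. -/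
theorem log_one_add_exp_add_le (y d : ℝ) :
    Real.log (1 + Real.exp (y + d))
      ≤ Real.log (1 + Real.exp y) + Real.exp y / (1 + Real.exp y) * (Real.exp d - 1) := by
  have h1 : 0 < 1 + Real.exp y := by positivity
  have h2 : 0 < 1 + Real.exp (y + d) := by positivity
  have h3 := Real.log_le_sub_one_of_pos (div_pos h2 h1)
  rw [Real.log_div h2.ne' h1.ne'] at h3
  have h4 : (1 + Real.exp (y + d)) / (1 + Real.exp y) - 1
      = Real.exp y / (1 + Real.exp y) * (Real.exp d - 1) := by
    rw [Real.exp_add]; field_simp; ring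
  linarith

/-- Logistic boosting of the posterior probability of `D₁` under the mixture of `D₀` and `D₁`
gives proxies for both distributions. -/
theorem exists_two_proxies (s k : ℕ) {ε : ℝ} (hε : 0 < ε) (hε1 : ε ≤ 1 / 2)
    (D₀ D₁ : PMF (Fin n → Bool)) :
    ∃ t : ℕ, (t : ℝ) ≤ 256 / ε ^ 2 ∧ ∃ P₀ P₁ : PMF (Fin n → Bool),
      dCirc s D₀ P₀ ≤ ε / 2 ∧ dCirc s D₁ P₁ ≤ ε / 2 ∧
      ∀ s', k * (t * (s + 12 * (k * t) + 16) + 1) + 1 ≤ s' →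
        dTV (iid P₀ k) (iid P₁ k) ≤ dCirc s' (iid D₀ k) (iid D₁ k) + k * ε := by
  set a : (Fin n → Bool) → ℝ := fun x => (D₀ x).toReal with ha
  set b : (Fin n → Bool) → ℝ := fun x => (D₁ x).toReal with hb
  have ha0 : ∀ x, 0 ≤ a x := fun x => ENNReal.toReal_nonneg
  have hb0 : ∀ x, 0 ≤ b x := fun x => ENNReal.toReal_nonneg
  have ha1 : ∑ x, a x = 1 := sum_toReal_eq_one D₀
  have hb1 : ∑ x, b x = 1 := sum_toReal_eq_one D₁
  -- normalization doubles the error, which leaves `ε / 2` for a proxy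
  set δ := ε / 4 with hδ
  have hδ0 : 0 < δ := by positivity
  have hη : 0 < δ / 4 := by positivity
  -- the cap lies beyond every level that the boosting can reach
  set K : ℤ := ⌈256 / ε ^ 2⌉ + 1 with hK
  have hKr : 256 / ε ^ 2 < K := by
    have := Int.le_ceil (256 / ε ^ 2)
    rw [hK]; push_cast; linarith
  have hK0 : 0 ≤ K := by
    have : (0 : ℝ) < K := lt_of_le_of_lt (by positivity) hKr
    exact_mod_cast this.le
  obtain ⟨t, h, hh, -, ht, -, hgood⟩ := exists_boost s (α := fun x => a x + b x) (b := b)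
    (fun x => add_nonneg (ha0 x) (hb0 x)) hb0 hb1 (ψ := fun y => Real.log (1 + Real.exp y))
    (ρ := fun y => Real.exp y / (1 + Real.exp y)) (fun y => by positivity)
    log_one_add_exp_add_le hδ0 (by linarith) hK0 (B := 0) (fun h _ => by
      rw [neg_zero]
      refine Finset.sum_nonneg fun x _ => ?_
      set y := δ / 4 * (h x : ℝ)
      have h1 : 0 ≤ Real.log (1 + Real.exp y) :=
        Real.log_nonneg (by linarith [Real.exp_pos y])
      have h2 : y ≤ Real.log (1 + Real.exp y) := by
        rw [Real.le_log_iff_exp_le (by positivity)]; linarith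
      nlinarith [mul_nonneg (ha0 x) h1, mul_le_mul_of_nonneg_left h2 (hb0 x)])
  have ht' : (t : ℝ) ≤ 256 / ε ^ 2 := by
    have hlog : Real.log (1 + Real.exp 0) ≤ 1 := by
      have := Real.log_le_sub_one_of_pos (show (0 : ℝ) < 1 + Real.exp 0 by positivity)
      rw [Real.exp_zero] at this ⊢
      linarith
    rw [Finset.sum_add_distrib, ha1, hb1] at ht
    rw [le_div_iff₀ (by positivity)]
    have : (t : ℝ) * (δ ^ 2 / 8) = t * ε ^ 2 / 128 := by rw [hδ]; ring
    linarith
  have hhK : ∀ x, h x < K := by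
    intro x
    have h1 : ((h x : ℤ) : ℝ) ≤ t := by
      exact_mod_cast (abs_le.1 (hh.abs_le x)).2
    exact_mod_cast h1.trans_lt (ht'.trans_lt hKr)
  set Q₁ : (Fin n → Bool) → ℝ := fun x =>
    (a x + b x) * (Real.exp (δ / 4 * h x) / (1 + Real.exp (δ / 4 * h x))) with hQ₁
  set Q₀ : (Fin n → Bool) → ℝ := fun x =>
    (a x + b x) * (1 / (1 + Real.exp (δ / 4 * h x))) with hQ₀
  have hsum : ∀ x, a x - Q₀ x = -(b x - Q₁ x) := by
    intro x
    have : 0 < 1 + Real.exp (δ / 4 * h x) := by positivity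
    simp only [hQ₀, hQ₁]
    field_simp
    ring
  have good₁ : ∀ r ≤ s, ∀ (C : Circuit (Fin n) r) (j : ℤ),
      |∑ x, if C.eval x && decide (h x < j) then b x - Q₁ x else 0| ≤ δ := by
    simpa only [hhK, if_true] using hgood
  have good₀ : ∀ r ≤ s, ∀ (C : Circuit (Fin n) r) (j : ℤ),
      |∑ x, if C.eval x && decide (h x < j) then a x - Q₀ x else 0| ≤ δ := by
    intro r hr C j
    rw [← abs_neg, ← Finset.sum_neg_distrib]
    convert good₁ r hr C j using 3 with x
    rw [hsum]
    split_ifs <;> simp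
  have hQ₁0 : ∀ x, 0 ≤ Q₁ x := fun x =>
    mul_nonneg (add_nonneg (ha0 x) (hb0 x)) (by positivity)
  have hQ₀0 : ∀ x, 0 ≤ Q₀ x := fun x =>
    mul_nonneg (add_nonneg (ha0 x) (hb0 x)) (by positivity)
  obtain ⟨circ₁, thr₁, const₁⟩ := bounds_of_joint_tests (fun x => (hhK x).le) good₁
  obtain ⟨circ₀, thr₀, const₀⟩ := bounds_of_joint_tests (fun x => (hhK x).le) good₀
  obtain ⟨hm₁, P₁, hP₁, hD₁⟩ := exists_pmf_normalize D₁ hQ₁0 (by linarith : δ < 1) const₁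
  obtain ⟨hm₀, P₀, hP₀, hD₀⟩ := exists_pmf_normalize D₀ hQ₀0 (by linarith : δ < 1) const₀
  set m₀ := ∑ y, Q₀ y
  set m₁ := ∑ y, Q₁ y
  obtain ⟨θ, hθ⟩ := exists_dTV_iid_le_sumTest (P₀ := P₀) (P₁ := P₁) (h := h) (K := K) (k := k)
    hη (div_pos hm₀ hm₁) (fun y _ => by
      rw [hP₀, hP₁]
      have : 0 < 1 + Real.exp (δ / 4 * h y) := by positivity
      simp only [hQ₀, hQ₁]
      field_simp)
  refine ⟨t, ht', P₀, P₁, dCirc_le fun r hr C => (hD₀ _ (circ₀ r hr C)).trans (by linarith),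
    dCirc_le fun r hr C => (hD₁ _ (circ₁ r hr C)).trans (by linarith),
    fun s' hs' => hh.dTV_iid_le_dCirc_iid hs' (fun j => hD₀ _ (thr₀ j))
      (fun j => hD₁ _ (thr₁ j)) hθ ?_⟩
  have : accept P₀ (fun y => decide (K ≤ h y)) = 0 := by
    simp [accept, (hhK _).not_ge]
  rw [this]; linarith

/-- Exponential boosting of the density of `D₁` with respect to `D₀`, capped where it reaches
`exp B` for `B` about `8 / ε`, gives a proxy for `D₁` alone. -/
theorem exists_single_proxy (s k : ℕ) {ε : ℝ} (hε : 0 < ε) (hε1 : ε ≤ 1 / 2)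
    (D₀ D₁ : PMF (Fin n → Bool)) :
    ∃ t : ℕ, (t : ℝ) ≤ 1152 / ε ^ 3 ∧ ∃ P₁ : PMF (Fin n → Bool), dCirc s D₁ P₁ ≤ ε / 2 ∧
      ∀ s', k * (t * (s + 12 * (k * t) + 16) + 1) + 1 ≤ s' →
        dTV (iid D₀ k) (iid P₁ k) ≤ dCirc s' (iid D₀ k) (iid D₁ k) + k * ε := by
  set a : (Fin n → Bool) → ℝ := fun x => (D₀ x).toReal with ha
  set b : (Fin n → Bool) → ℝ := fun x => (D₁ x).toReal with hb
  have ha0 : ∀ x, 0 ≤ a x := fun x => ENNReal.toReal_nonneg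
  have hb0 : ∀ x, 0 ≤ b x := fun x => ENNReal.toReal_nonneg
  have ha1 : ∑ x, a x = 1 := sum_toReal_eq_one D₀
  have hb1 : ∑ x, b x = 1 := sum_toReal_eq_one D₁
  -- normalization doubles the error, which leaves `ε / 2` for a proxy
  set δ := ε / 4 with hδ
  have hδ0 : 0 < δ := by positivity
  have hη : 0 < δ / 4 := by positivity
  set K : ℤ := ⌈128 / ε ^ 2⌉ with hK
  have hK0 : 0 ≤ K := Int.ceil_nonneg (by positivity)
  set B : ℝ := δ / 4 * K with hB
  have hB1 : 8 / ε ≤ B := by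
    have h1 := mul_le_mul_of_nonneg_left (Int.le_ceil (128 / ε ^ 2)) hη.le
    refine le_trans (le_of_eq ?_) h1
    rw [hδ]; field_simp; norm_num
  have hB2 : B ≤ 8 / ε + 1 := by
    have h1 := mul_le_mul_of_nonneg_left (Int.ceil_lt_add_one (128 / ε ^ 2)).le hη.le
    have h2 : δ / 4 * (128 / ε ^ 2 + 1) = 8 / ε + ε / 16 := by
      rw [hδ]; field_simp; ring
    rw [h2] at h1
    linarith
  have hlin : ∀ h : (Fin n → Bool) → ℤ, (∀ x, h x ≤ K) →
      ∑ x, b x * (δ / 4 * h x) ≤ B := by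
    intro h hhK
    calc ∑ x, b x * (δ / 4 * h x) ≤ ∑ x, b x * B := by
          refine Finset.sum_le_sum fun x _ => mul_le_mul_of_nonneg_left ?_ (hb0 x)
          exact mul_le_mul_of_nonneg_left (by exact_mod_cast hhK x) hη.le
      _ = B := by rw [← Finset.sum_mul, hb1, one_mul]
  obtain ⟨t, h, hh, hhK, ht, hpot, hgood⟩ := exists_boost s (α := a) (b := b)
    ha0 hb0 hb1 (ψ := Real.exp) (ρ := Real.exp) (fun y => (Real.exp_pos y).le)
    (fun y d => by rw [Real.exp_add]; linarith) hδ0 (by linarith) hK0 (B := B) (fun h hhK => by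
      rw [potential, Finset.sum_sub_distrib]
      have : 0 ≤ ∑ x, a x * Real.exp (δ / 4 * h x) :=
        Finset.sum_nonneg fun x _ => mul_nonneg (ha0 x) (Real.exp_pos _).le
      linarith [hlin h hhK])
  rw [ha1, Real.exp_zero, one_mul] at ht hpot
  have ht' : (t : ℝ) ≤ 1152 / ε ^ 3 := by
    have h1 : (t : ℝ) * (δ ^ 2 / 8) = t * ε ^ 2 / 128 := by rw [hδ]; ring
    have h2 : 2 ≤ 1 / ε := by rw [le_div_iff₀ hε]; linarith
    have h3 : (t : ℝ) * ε ^ 2 ≤ 128 * (9 * (1 / ε)) := by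
      have : 8 / ε = 8 * (1 / ε) := by ring
      linarith
    rw [le_div_iff₀ (by positivity)]
    calc (t : ℝ) * ε ^ 3 = t * ε ^ 2 * ε := by ring
      _ ≤ 128 * (9 * (1 / ε)) * ε := mul_le_mul_of_nonneg_right h3 hε.le
      _ = 1152 := by field_simp; norm_num
  -- the potential bounds the probability of the capped set under `D₀` by `(1 + B) * exp (-B)`
  have hcap : accept D₀ (fun y => decide (K ≤ h y)) ≤ ε / 2 := by
    have h1 : accept D₀ (fun y => decide (K ≤ h y)) * Real.exp B
        ≤ ∑ x, a x * Real.exp (δ / 4 * h x) := by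
      rw [accept, Finset.sum_mul]
      refine Finset.sum_le_sum fun x _ => ?_
      by_cases hx : K ≤ h x
      · have : h x = K := le_antisymm (hhK x) hx
        simp [this, hB, ha]
      · simpa [hx] using mul_nonneg (ha0 x) (Real.exp_pos _).le
    have h2 : ∑ x, a x * Real.exp (δ / 4 * h x) ≤ 1 + B := by
      rw [potential, Finset.sum_sub_distrib] at hpot
      linarith [hlin h hhK]
    have hBpos : 0 ≤ B := le_trans (by positivity) hB1
    have h3 := Real.quadratic_le_exp_of_nonneg hBpos
    have h4 : 8 ≤ B * ε := by rwa [div_le_iff₀ hε] at hB1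
    have h5 : 1 + B ≤ ε / 2 * Real.exp B := by
      have h6 := mul_le_mul_of_nonneg_left h3 (by positivity : (0 : ℝ) ≤ ε / 2)
      have h7 := mul_le_mul_of_nonneg_right h4 hBpos
      nlinarith
    exact le_of_mul_le_mul_right ((h1.trans h2).trans h5) (Real.exp_pos B)
  set Q : (Fin n → Bool) → ℝ := fun x =>
    if h x < K then a x * Real.exp (δ / 4 * h x) else b x with hQ
  have hQ0 : ∀ x, 0 ≤ Q x := by
    intro x
    simp only [hQ]
    split_ifs
    · exact mul_nonneg (ha0 x) (Real.exp_pos _).le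
    · exact hb0 x
  have good : ∀ r ≤ s, ∀ (C : Circuit (Fin n) r) (j : ℤ),
      |∑ x, if C.eval x && decide (h x < j) then b x - Q x else 0| ≤ δ := hgood
  obtain ⟨circ, thr, const⟩ := bounds_of_joint_tests hhK good
  obtain ⟨hm, P₁, hP₁, hD₁⟩ := exists_pmf_normalize D₁ hQ0 (by linarith : δ < 1) const
  obtain ⟨θ, hθ⟩ := exists_dTV_iid_le_sumTest (P₀ := D₀) (P₁ := P₁) (h := h) (K := K) (k := k)
    hη (one_div_pos.2 hm) (fun y hy => by
      rw [hP₁]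
      simp only [hQ, hy, if_true]
      ring)
  exact ⟨t, ht', P₁, dCirc_le fun r hr C => (hD₁ _ (circ r hr C)).trans (by linarith),
    fun s' hs' => hh.dTV_iid_le_dCirc_iid hs' (δ₀ := 0) (fun j => by simp)
      (fun j => hD₁ _ (thr j)) hθ (by linarith)⟩

theorem exists_pmf_midpoint (D₀ D₁ : PMF (Fin n → Bool)) :
    ∃ P : PMF (Fin n → Bool), dTV D₀ P ≤ 1 / 2 ∧ dTV D₁ P ≤ 1 / 2 := by
  obtain ⟨P, hP⟩ := exists_pmf_toReal_eq (q := fun x => ((D₀ x).toReal + (D₁ x).toReal) / 2)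
    (fun x => by positivity)
    (by rw [← Finset.sum_div, Finset.sum_add_distrib, sum_toReal_eq_one, sum_toReal_eq_one]
        norm_num)
  have h1 : dTV D₀ P = dTV D₀ D₁ / 2 := by
    simp only [dTV, hP]
    rw [mul_div_assoc, Finset.sum_div]
    congr 1
    refine Finset.sum_congr rfl fun x _ => ?_
    rw [← abs_of_pos (two_pos (α := ℝ)), ← abs_div, abs_of_pos (two_pos (α := ℝ))]
    congr 1; ring
  have h2 : dTV D₁ P = dTV D₀ D₁ / 2 := by
    simp only [dTV, hP]
    rw [mul_div_assoc, Finset.sum_div]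
    congr 1
    refine Finset.sum_congr rfl fun x _ => ?_
    rw [abs_sub_comm, ← abs_of_pos (two_pos (α := ℝ)), ← abs_div, abs_of_pos (two_pos (α := ℝ))]
    congr 1; ring
  have := dTV_le_one D₀ D₁
  exact ⟨P, by linarith, by linarith⟩

/-- When `k = 0` or `ε ≥ 1/2`, a proxy for `D₁` exists outright, and distinguishers of size `0`
suffice in the upper bound. -/
theorem exists_proxy_of_eq_zero_or_half_le (s k : ℕ) {ε : ℝ} (hε : 0 < ε)
    (h : k = 0 ∨ 1 / 2 ≤ ε) (D₀ D₁ : PMF (Fin n → Bool)) :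
    ∃ P₁ : PMF (Fin n → Bool), dCirc s D₁ P₁ ≤ ε ∧
      dTV (iid D₀ k) (iid P₁ k) ≤ dCirc 0 (iid D₀ k) (iid D₁ k) + k * ε := by
  have h0 := dCirc_nonneg 0 (iid D₀ k) (iid D₁ k)
  rcases h with rfl | h
  · refine ⟨D₁, (dCirc_self s D₁).trans hε.le, ?_⟩
    have := dTV_iid_le (k := 0) D₀ D₁
    simp only [Nat.cast_zero, zero_mul] at this ⊢
    linarith
  -- the midpoint of `D₀` and `D₁` is within `1 / 2` of both, even in total variation
  · obtain ⟨P, hP₀, hP₁⟩ := exists_pmf_midpoint D₀ D₁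
    refine ⟨P, (dCirc_le_dTV s D₁ P).trans (hP₁.trans h), ?_⟩
    have h1 := dTV_iid_le (k := k) D₀ P
    have h2 := mul_le_mul_of_nonneg_left (hP₀.trans h) (Nat.cast_nonneg (α := ℝ) k)
    linarith

/-- The size of the circuit for `sumTest` meets the bound. All terms but the one with the factor
`s` are polynomial in `k / ε ≥ 2`, so a large exponent absorbs their constant factors. -/
theorem circuit_size_le {s k t q : ℕ} {ε : ℝ} (hε : 0 < ε) (hε1 : ε ≤ 1 / 2) (hk : k ≠ 0)
    (hq : q ≤ 4) (ht : (t : ℝ) ≤ 1152 / ε ^ q) :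
    ((k * (t * (s + 12 * (k * t) + 16) + 1) + 1 : ℕ) : ℝ)
      ≤ (1152 : ℕ) * (s * k / ε ^ q) + (k / ε) ^ 32 := by
  have hk1 : (1 : ℝ) ≤ k := by exact_mod_cast Nat.one_le_iff_ne_zero.2 hk
  set u : ℝ := k / ε with hu
  have hku : (k : ℝ) ≤ u := by
    rw [hu, le_div_iff₀ hε]; nlinarith
  have hu2 : 2 ≤ u := by
    rw [hu, le_div_iff₀ hε]; linarith
  have hkt : (k : ℝ) * t ≤ 1152 * (k / ε ^ q) := by
    refine (mul_le_mul_of_nonneg_left ht (by linarith)).trans_eq ?_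
    ring
  have hkq : (k : ℝ) / ε ^ q ≤ u ^ 4 := by
    rw [hu, div_pow]
    exact div_le_div₀ (by positivity) (le_self_pow₀ hk1 (by norm_num)) (by positivity)
      (pow_le_pow_of_le_one hε.le (by linarith) hq)
  have hkt4 : (k : ℝ) * t ≤ 1152 * u ^ 4 := by linarith
  have h1 : (k : ℝ) * t * s ≤ 1152 * (s * k / ε ^ q) :=
    (mul_le_mul_of_nonneg_right hkt (Nat.cast_nonneg s)).trans_eq (by ring)
  have h2 : (k : ℝ) * t * (12 * (k * t) + 16) ≤ 1152 * u ^ 4 * (12 * (1152 * u ^ 4) + 16) :=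
    mul_le_mul hkt4 (by linarith) (by positivity) (by positivity)
  have h3 : u ≤ u ^ 8 := le_self_pow₀ (by linarith) (by norm_num)
  have h4 : u ^ 4 ≤ u ^ 8 := pow_le_pow_right₀ (by linarith) (by norm_num)
  have h5 : (2 : ℝ) ^ 24 * u ^ 8 ≤ u ^ 32 := by
    rw [show u ^ 32 = u ^ 24 * u ^ 8 by ring]
    exact mul_le_mul_of_nonneg_right (pow_le_pow_left₀ (by norm_num) hu2 24) (by positivity)
  push_cast
  nlinarith

end Proxies

end CircuitDist

theorem mainTheorem6 :
    ∃ A c : ℕ,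
      -- two proxies
      (∀ (s k : ℕ) (ε : ℝ), 0 < ε →
        ∃ s' : ℕ, (s' : ℝ) ≤ A * (s * k / ε ^ 2) + (k / ε) ^ c ∧
          ∀ (n : ℕ) (D₀ D₁ : PMF (Fin n → Bool)),
            ∃ P₀ P₁ : PMF (Fin n → Bool),
              CircuitDist.dCirc s D₀ P₀ ≤ ε ∧
              CircuitDist.dCirc s D₁ P₁ ≤ ε ∧
              CircuitDist.dCirc s (CircuitDist.iid D₀ k) (CircuitDist.iid D₁ k) - k * ε
                ≤ CircuitDist.dTV (CircuitDist.iid P₀ k) (CircuitDist.iid P₁ k) ∧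
              CircuitDist.dTV (CircuitDist.iid P₀ k) (CircuitDist.iid P₁ k)
                ≤ CircuitDist.dCirc s' (CircuitDist.iid D₀ k) (CircuitDist.iid D₁ k) + k * ε) ∧
      -- a single proxy: the proxy of `D₀` is `D₀` itself
      (∀ (s k : ℕ) (ε : ℝ), 0 < ε →
        ∃ s' : ℕ, (s' : ℝ) ≤ A * (s * k / ε ^ 4) + (k / ε) ^ c ∧
          ∀ (n : ℕ) (D₀ D₁ : PMF (Fin n → Bool)),
            ∃ P₀ P₁ : PMF (Fin n → Bool), P₀ = D₀ ∧
              CircuitDist.dCirc s D₀ P₀ ≤ ε ∧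
              CircuitDist.dCirc s D₁ P₁ ≤ ε ∧
              CircuitDist.dCirc s (CircuitDist.iid D₀ k) (CircuitDist.iid D₁ k) - k * ε
                ≤ CircuitDist.dTV (CircuitDist.iid P₀ k) (CircuitDist.iid P₁ k) ∧
              CircuitDist.dTV (CircuitDist.iid P₀ k) (CircuitDist.iid P₁ k)
                ≤ CircuitDist.dCirc s' (CircuitDist.iid D₀ k) (CircuitDist.iid D₁ k) + k * ε) := by
  -- the lower bound holds for all proxies whose circuit distances add up to at most `ε`
  have lower : ∀ {n : ℕ} (s k : ℕ) {ε : ℝ} (D₀ D₁ P₀ P₁ : PMF (Fin n → Bool)),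
      CircuitDist.dCirc s D₀ P₀ + CircuitDist.dCirc s D₁ P₁ ≤ ε →
      CircuitDist.dCirc s (CircuitDist.iid D₀ k) (CircuitDist.iid D₁ k) - k * ε
        ≤ CircuitDist.dTV (CircuitDist.iid P₀ k) (CircuitDist.iid P₁ k) := by
    intro n s k ε D₀ D₁ P₀ P₁ h
    have h1 := CircuitDist.dCirc_iid_sub_le_dTV_iid (k := k) s D₀ D₁ P₀ P₁
    have h2 := mul_le_mul_of_nonneg_left h (Nat.cast_nonneg (α := ℝ) k)
    linarith
  refine ⟨1152, 32, fun s k ε hε => ?_, fun s k ε hε => ?_⟩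
  · by_cases h : k = 0 ∨ 1 / 2 ≤ ε
    · refine ⟨0, by push_cast; positivity, fun n D₀ D₁ => ?_⟩
      obtain ⟨P₁, h1, h2⟩ := CircuitDist.exists_proxy_of_eq_zero_or_half_le s k hε h D₀ D₁
      have h0 := CircuitDist.dCirc_self s D₀
      exact ⟨D₀, P₁, h0.trans hε.le, h1, lower s k D₀ D₁ D₀ P₁ (by linarith), h2⟩
    · rw [not_or, not_le] at h
      refine ⟨_, Nat.floor_le (by positivity), fun n D₀ D₁ => ?_⟩
      obtain ⟨t, ht, P₀, P₁, h0, h1, h2⟩ :=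
        CircuitDist.exists_two_proxies s k hε h.2.le D₀ D₁
      refine ⟨P₀, P₁, by linarith, by linarith, lower s k D₀ D₁ P₀ P₁ (by linarith),
        h2 _ (Nat.le_floor (CircuitDist.circuit_size_le hε h.2.le h.1 (by norm_num) ?_))⟩
      exact ht.trans (div_le_div_of_nonneg_right (by norm_num) (by positivity))
  · by_cases h : k = 0 ∨ 1 / 2 ≤ ε
    · refine ⟨0, by push_cast; positivity, fun n D₀ D₁ => ?_⟩
      obtain ⟨P₁, h1, h2⟩ := CircuitDist.exists_proxy_of_eq_zero_or_half_le s k hε h D₀ D₁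
      have h0 := CircuitDist.dCirc_self s D₀
      exact ⟨D₀, P₁, rfl, h0.trans hε.le, h1, lower s k D₀ D₁ D₀ P₁ (by linarith), h2⟩
    · rw [not_or, not_le] at h
      refine ⟨_, Nat.floor_le (by positivity), fun n D₀ D₁ => ?_⟩
      obtain ⟨t, ht, P₁, h1, h2⟩ := CircuitDist.exists_single_proxy s k hε h.2.le D₀ D₁
      have h0 := CircuitDist.dCirc_self s D₀
      refine ⟨D₀, P₁, rfl, by linarith, by linarith, lower s k D₀ D₁ D₀ P₁ (by linarith),
        h2 _ (Nat.le_floor (CircuitDist.circuit_size_le hε h.2.le h.1 le_rfl ?_))⟩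
      exact ht.trans (div_le_div_of_nonneg_left (by norm_num) (by positivity)
        (pow_le_pow_of_le_one hε.le (by linarith) (by norm_num)))
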